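/- **Theorem (Balanced realization; robustness of the Ho–Kalman algorithm).** Let $n,p\ge 1$ and $L\ge 2$, and write $h=\lfloor L/2\rfloor$ (so $h=L/2$ for even $L$). Let $\mathbf A\in\mathbb R^{n\times n}$, $\mathbf B\in\mathbb R^{n\times p}$, $\mathbf C\in\mathbb R^{p\times n}$ be such that $(\mathbf A,\mathbf B)$ is controllable and $(\mathbf A,\mathbf C)$ is observable. Let $$\mathbf G=[\mathbf C\mathbf B\;\;\mathbf C\mathbf A\mathbf B\;\cdots\;\mathbf C\mathbf A^{L-1}\mathbf B]\in\mathbb R^{p\times pL},$$ $$\mathbf O=\begin{bmatrix}\mathbf C\\ \mathbf C\mathbf A\\ \vdots\\ \mathbf C\mathbf A^{h-1}\end{bmatrix},\qquad \mathbf Q=[\mathbf B\;\;\mathbf A\mathbf B\;\cdots\;\mathbf A^{h}\mathbf B],\qquad \mathbf H=\mathbf O\mathbf Q\in\mathbb R^{ph\times p(h+1)}.$$ The $(i,j)$ block of $\mathbf H$ is the $(i+j)$-th block $\mathbf C\mathbf A^{i+j}\mathbf B$ of $\mathbf G$ (indices from $0$). For an arbitrary matrix $\hat{\mathbf G}\in\mathbb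 R^{p\times pL}$ with $p\times p$ blocks $\hat{\mathbf G}_0,\dots,\hat{\mathbf G}_{L-1}$, let $\hat{\mathbf H}\in\mathbb R^{ph\times p(h+1)}$ be the block Hankel matrix whose $(i,j)$ block is $\hat{\mathbf G}_{i+j}$. *Ho–Kalman algorithm* (order $n$, input a matrix $\mathbf M\in\mathbb R^{ph\times p(h+1)}$). Let $\mathbf M^-$ and $\mathbf M^+$ be $\mathbf M$ without its last, respectively first, $p$ columns. Let $\mathbf K$ be a best Frobenius-norm approximation of $\mathbf M^-$ by matrices of rank at most $n$, and let $\mathbf K=\mathbf U\boldsymbol\Sigma\mathbf V^*$ be a singular value decomposition, with $\mathbf U,\mathbf V\in\mathbb R^{ph\times n}$ having orthonormal columns and $\boldsymbol\Sigma\in\mathbb R^{n\times n}$ diagonal and nonnegative. Put $\mathbf O_{\mathbf M}=\mathbf U\boldsymbol\Sigma^{1/2}$ and $\mathbf Q_{\mathbf M}=\boldsymbol\Sigma^{1/2}\mathbf V^*$. The output is $(\mathbf O_{\mathbf M}^\dagger\mathbf M^+\mathbf Q_{\mathbf M}^\dagger,\ \text{first } p \text{ columns of } \mathbf Q_{\mathbf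 M},\ \text{first } p \text{ rows of } \mathbf O_{\mathbf M})$, where $\dagger$ is the Moore–Penrose pseudoinverse. Let $(\bar{\mathbf A},\bar{\mathbf B},\bar{\mathbf C})$ and $(\hat{\mathbf A},\hat{\mathbf B},\hat{\mathbf C})$ be any outputs of this algorithm (for any choice of the decompositions) with inputs $\mathbf H$ and $\hat{\mathbf H}$, respectively. Let $\mathbf L$ be the best approximation of $\mathbf H^-$ of rank at most $n$, and let $\sigma_{\min}(\mathbf L)$ be its $n$-th largest singular value. Write $\|\cdot\|$ for the spectral norm and $\|\cdot\|_F$ for the Frobenius norm. If $$\sigma_{\min}(\mathbf L)>0\qquad\text{and}\qquad \|\mathbf G-\hat{\mathbf G}\|_F\le\frac{\sigma_{\min}(\mathbf L)}{2\sqrt{2L}},$$ then there is an orthogonal (real unitary) matrix $\mathbf T\in\mathbb R^{n\times n}$ such that both $$\max\{\|\bar{\mathbf B}-\mathbf T^*\hat{\mathbf B}\|_F,\ \|\bar{\mathbf C}-\hat{\mathbf C}\mathbf T\|_F\}\le\sqrt{\frac{L}{\sigma_{\min}(\mathbf L)}}\;\|\mathbf G-\hat{\mathbf G}\|_F,$$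 $$\|\bar{\mathbf A}-\mathbf T^*\hat{\mathbf A}\mathbf T\|_F\le\sqrt L\left(\frac{\|\mathbf H\|+\|\hat{\mathbf H}\|}{\sigma_{\min}(\mathbf L)^2}+\frac1{\sigma_{\min}(\mathbf L)}\right)\|\mathbf G-\hat{\mathbf G}\|_F.$$ -/

import Mathlib

noncomputable section

namespace HoKalman

/-- The Frobenius norm of a real matrix. -/
def frobNorm {m k : Type*} [Fintype m] [Fintype k] (M : Matrix m k ℝ) : ℝ :=
  @Norm.norm (Matrix m k ℝ) Matrix.frobeniusNormedAddCommGroup.toNorm M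

/-- The spectral norm (Euclidean operator norm) of a real matrix. -/
def specNorm {m k : Type*} [Fintype m] [Fintype k] [DecidableEq k] (M : Matrix m k ℝ) : ℝ :=
  @Norm.norm (Matrix m k ℝ) Matrix.instL2OpNormedAddCommGroup.toNorm M

/-- The `n`-th largest singular value of a real matrix, counted from `1` and with multiplicity.
Mathlib's sequence `LinearMap.singularValues` is decreasing and counts from `0`. -/
def nthSingularValue (n : ℕ) {m k : Type*} [Fintype m] [Fintype k] [DecidableEq k]
    (M : Matrix m k ℝ) : ℝ :=
  (Matrix.toEuclideanLin M).singularValues (n - 1)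

/-- The block row `[B, A B, ..., A ^ (k - 1) B]`; the column `(j, b)` is the column `b` of the
`j`-th block. -/
def controllabilityMatrix {n p : ℕ} (A : Matrix (Fin n) (Fin n) ℝ) (B : Matrix (Fin n) (Fin p) ℝ)
    (k : ℕ) : Matrix (Fin n) (Fin k × Fin p) ℝ :=
  Matrix.of fun i c => (A ^ (c.1 : ℕ) * B) i c.2

/-- The block column `[C; C A; ...; C A ^ (k - 1)]`; the row `(i, a)` is the row `a` of the
`i`-th block. -/
def observabilityMatrix {n p : ℕ} (A : Matrix (Fin n) (Fin n) ℝ) (C : Matrix (Fin p) (Fin n) ℝ)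
    (k : ℕ) : Matrix (Fin k × Fin p) (Fin n) ℝ :=
  Matrix.of fun r j => (C * A ^ (r.1 : ℕ)) r.2 j

/-- The pair `(A, B)` is controllable (Kalman's rank criterion). -/
def IsControllable {n p : ℕ} (A : Matrix (Fin n) (Fin n) ℝ) (B : Matrix (Fin n) (Fin p) ℝ) : Prop :=
  (controllabilityMatrix A B n).rank = n

/-- The pair `(A, C)` is observable (Kalman's rank criterion). -/
def IsObservable {n p : ℕ} (A : Matrix (Fin n) (Fin n) ℝ) (C : Matrix (Fin p) (Fin n) ℝ) : Prop :=
  (observabilityMatrix A C n).rank = n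

/-- The matrix `G = [C B, C A B, ..., C A ^ (L - 1) B]` of the first `L` Markov parameters. -/
def markovMatrix {n p : ℕ} (A : Matrix (Fin n) (Fin n) ℝ) (B : Matrix (Fin n) (Fin p) ℝ)
    (C : Matrix (Fin p) (Fin n) ℝ) (L : ℕ) : Matrix (Fin p) (Fin L × Fin p) ℝ :=
  Matrix.of fun a c => (C * A ^ (c.1 : ℕ) * B) a c.2

/-- The clipped Hankel matrix `H = O Q` of the system, where `O = [C; C A; ...; C A ^ (L/2 - 1)]`
and `Q = [B, A B, ..., A ^ (L/2) B]`. -/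
def clippedHankel {n p : ℕ} (A : Matrix (Fin n) (Fin n) ℝ) (B : Matrix (Fin n) (Fin p) ℝ)
    (C : Matrix (Fin p) (Fin n) ℝ) (L : ℕ) :
    Matrix (Fin (L / 2) × Fin p) (Fin (L / 2 + 1) × Fin p) ℝ :=
  observabilityMatrix A C (L / 2) * controllabilityMatrix A B (L / 2 + 1)

/-- The clipped block Hankel matrix constructed from a matrix `G = [G₀, ..., G_{L-1}]` of `p × p`
blocks: its block in position `(i, j)` is `G_{i+j}`. -/
def hankelOf {p L : ℕ} (G : Matrix (Fin p) (Fin L × Fin p) ℝ) :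
    Matrix (Fin (L / 2) × Fin p) (Fin (L / 2 + 1) × Fin p) ℝ :=
  Matrix.of fun r c => G r.2 (⟨(r.1 : ℕ) + (c.1 : ℕ), by omega⟩, c.2)

/-- The clipped Hankel matrix of a system is the one constructed from its Markov parameters. -/
theorem clippedHankel_eq_hankelOf {n p : ℕ} (A : Matrix (Fin n) (Fin n) ℝ)
    (B : Matrix (Fin n) (Fin p) ℝ) (C : Matrix (Fin p) (Fin n) ℝ) (L : ℕ) :
    clippedHankel A B C L = hankelOf (markovMatrix A B C L) := by
  ext r c
  have h : C * A ^ ((r.1 : ℕ) + (c.1 : ℕ)) * B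
      = (C * A ^ (r.1 : ℕ)) * (A ^ (c.1 : ℕ) * B) := by
    simp only [pow_add, Matrix.mul_assoc]
  simp only [hankelOf, markovMatrix, Matrix.of_apply, h]
  rfl

/-- `H⁻`: the last block column (that is, the last `p` columns) of `H` is deleted. -/
def hankelMinus {p k : ℕ} (H : Matrix (Fin k × Fin p) (Fin (k + 1) × Fin p) ℝ) :
    Matrix (Fin k × Fin p) (Fin k × Fin p) ℝ :=
  H.submatrix id (fun c => (c.1.castSucc, c.2))

/-- `H⁺`: the first block column (that is, the first `p` columns) of `H` is deleted. -/
def hankelPlus {p k : ℕ} (H : Matrix (Fin k × Fin p) (Fin (k + 1) × Fin p) ℝ) :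
    Matrix (Fin k × Fin p) (Fin k × Fin p) ℝ :=
  H.submatrix id (fun c => (c.1.succ, c.2))

/-- `K` is a best approximation of `M` of rank at most `n` in the Frobenius norm. -/
def IsBestRankApprox {m k : Type*} [Fintype m] [Fintype k] (n : ℕ) (M K : Matrix m k ℝ) : Prop :=
  K.rank ≤ n ∧ ∀ N : Matrix m k ℝ, N.rank ≤ n → frobNorm (M - K) ≤ frobNorm (M - N)

/-- `M = U Σ Vᵀ` is a (thin) singular value decomposition with `n` singular values: `U` and `V` have
orthonormal columns and `Σ = diag s` with `s ≥ 0`. No order of the singular values is imposed. -/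
structure IsThinSVD {m k : Type*} [Fintype m] [Fintype k] {n : ℕ} (M : Matrix m k ℝ)
    (U : Matrix m (Fin n) ℝ) (s : Fin n → ℝ) (V : Matrix k (Fin n) ℝ) : Prop where
  orth_left : U.transpose * U = 1
  orth_right : V.transpose * V = 1
  nonneg : ∀ i, 0 ≤ s i
  eq_mul : M = U * Matrix.diagonal s * V.transpose

/-- `X` is the Moore-Penrose pseudoinverse of the real matrix `M`. -/
structure IsPseudoinverse {m k : Type*} [Fintype m] [Fintype k]
    (M : Matrix m k ℝ) (X : Matrix k m ℝ) : Prop where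
  mul_mul_self : M * X * M = M
  mul_mul_inv : X * M * X = X
  symm_left : (M * X).transpose = M * X
  symm_right : (X * M).transpose = X * M

/-- `(A, B, C)` is an output of the Ho-Kalman algorithm of order `n` with input the clipped Hankel
matrix `H`, which has `k` block rows and `k + 1` block columns of size `p × p`:
* `K` is the rank-`n` approximation of `H⁻` and `K = U Σ Vᵀ` a singular value decomposition;
* `O = U Σ^{1/2}` and `Q = Σ^{1/2} Vᵀ`;
* `C` consists of the first `p` rows of `O`, `B` of the first `p` columns of `Q`,
  and `A = O† H⁺ Q†`.
A singular value decomposition is not unique, so this is a relation. -/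
def IsHoKalmanOutput (n : ℕ) {p k : ℕ} (hk : 0 < k)
    (H : Matrix (Fin k × Fin p) (Fin (k + 1) × Fin p) ℝ)
    (A : Matrix (Fin n) (Fin n) ℝ) (B : Matrix (Fin n) (Fin p) ℝ)
    (C : Matrix (Fin p) (Fin n) ℝ) : Prop :=
  ∃ (K : Matrix (Fin k × Fin p) (Fin k × Fin p) ℝ)
    (U : Matrix (Fin k × Fin p) (Fin n) ℝ) (s : Fin n → ℝ) (V : Matrix (Fin k × Fin p) (Fin n) ℝ)
    (O : Matrix (Fin k × Fin p) (Fin n) ℝ) (Q : Matrix (Fin n) (Fin k × Fin p) ℝ)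
    (Odag : Matrix (Fin n) (Fin k × Fin p) ℝ) (Qdag : Matrix (Fin k × Fin p) (Fin n) ℝ),
    IsBestRankApprox n (hankelMinus H) K ∧
    IsThinSVD K U s V ∧
    O = U * Matrix.diagonal (fun i => Real.sqrt (s i)) ∧
    Q = Matrix.diagonal (fun i => Real.sqrt (s i)) * V.transpose ∧
    IsPseudoinverse O Odag ∧
    IsPseudoinverse Q Qdag ∧
    C = O.submatrix (fun a => (⟨0, hk⟩, a)) id ∧
    B = Q.submatrix id (fun b => (⟨0, hk⟩, b)) ∧
    A = Odag * hankelPlus H * Qdag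

end HoKalman

end

/-!
Since `H⁻` factors through `ℝⁿ`, it is its own best rank-`n` approximation `L`, and the run on `H`
works with an exact balanced factorization `L = O Q`, `OᵀO = QQᵀ`. Let `K` be the best rank-`n`
approximation of `M = Ĥ⁻`, with balanced factorization `K = O' Q'`.

* The residual `R = M - K` satisfies `KᵀR = 0` and `KRᵀ = 0`, so `⟨L, R⟩ = ⟨(L - K) L† (L - K), R⟩`
  is of second order in `L - K`. Hence `3 ‖L - K‖² ≤ 4 ‖L - M‖²`, which improves on the factor `2`
  of the triangle inequality, and Weyl's inequality bounds the singular values of `K` below by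
  `7/10 σ`.
* The polar decomposition provides an orthogonal `T` for which `S = OᵀO'T + QQ'ᵀT` is positive
  semidefinite. The Gram matrix of the aligned differences `O - O'T` and `Q - TᵀQ'` is then
  `2 (OᵀO + (O'T)ᵀ(O'T) - S)`, and its trace is controlled by `‖L - K‖²`.
* Both factors have full rank `n`, so `Ā = O† H⁺ Q†` satisfies `O Ā Q = H⁺`. Substituting this in
  `Ā - Tᵀ Â T` leaves only terms with the differences of the factors and of `H⁺`, multiplied by the
  pseudoinverses of the perturbed factors.
-/

namespace HoKalman

open Matrix WithLp

section Frobenius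

open scoped Matrix.Norms.Frobenius

variable {l m k m' k' : Type*} [Fintype l] [Fintype m] [Fintype k] [Fintype m'] [Fintype k']

theorem frobNorm_nonneg (M : Matrix m k ℝ) : 0 ≤ frobNorm M :=
  norm_nonneg M

theorem frobNorm_add_le (M N : Matrix m k ℝ) : frobNorm (M + N) ≤ frobNorm M + frobNorm N :=
  norm_add_le M N

theorem frobNorm_sub_le (M N : Matrix m k ℝ) : frobNorm (M - N) ≤ frobNorm M + frobNorm N :=
  norm_sub_le M N

theorem frobNorm_sub_rev (M N : Matrix m k ℝ) : frobNorm (M - N) = frobNorm (N - M) :=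
  norm_sub_rev M N

theorem frobNorm_eq_zero {M : Matrix m k ℝ} : frobNorm M = 0 ↔ M = 0 :=
  norm_eq_zero

theorem frobNorm_mul_le (M : Matrix l m ℝ) (N : Matrix m k ℝ) :
    frobNorm (M * N) ≤ frobNorm M * frobNorm N :=
  frobenius_norm_mul M N

theorem frobNorm_transpose (M : Matrix m k ℝ) : frobNorm Mᵀ = frobNorm M :=
  frobenius_norm_transpose M

theorem frobNorm_sq_eq_sum (M : Matrix m k ℝ) : frobNorm M ^ 2 = ∑ i, ∑ j, M i j ^ 2 := by
  rw [frobNorm, frobenius_norm_def, ← Real.rpow_natCast, ← Real.rpow_mul (by positivity)]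
  simp

theorem frobNorm_sq_eq_trace (M : Matrix m k ℝ) : frobNorm M ^ 2 = (Mᵀ * M).trace := by
  rw [frobNorm_sq_eq_sum, Finset.sum_comm]
  simp [trace, mul_apply, sq]

theorem frobNorm_add_sq (M N : Matrix m k ℝ) :
    frobNorm (M + N) ^ 2 = frobNorm M ^ 2 + 2 * (Mᵀ * N).trace + frobNorm N ^ 2 := by
  have h : (Nᵀ * M).trace = (Mᵀ * N).trace := by
    rw [← trace_transpose, transpose_mul, transpose_transpose]
  simp only [frobNorm_sq_eq_trace, transpose_add, Matrix.add_mul, Matrix.mul_add, trace_add, h]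
  ring

theorem frobNorm_sub_sq (M N : Matrix m k ℝ) :
    frobNorm (M - N) ^ 2 = frobNorm M ^ 2 - 2 * (Mᵀ * N).trace + frobNorm N ^ 2 := by
  have h := frobNorm_add_sq (M - N) N
  rw [sub_add_cancel, transpose_sub, Matrix.sub_mul, trace_sub, ← frobNorm_sq_eq_trace] at h
  linarith

theorem sum_comp_le_sum_of_injective {ι κ : Type*} [Fintype ι] [Fintype κ] {f : κ → ℝ}
    (hf : ∀ i, 0 ≤ f i) {g : ι → κ} (hg : g.Injective) : ∑ i, f (g i) ≤ ∑ i, f i :=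
  (Finset.sum_map Finset.univ ⟨g, hg⟩ f).symm.trans_le (Finset.sum_le_univ_sum_of_nonneg hf)

theorem frobNorm_submatrix_le (M : Matrix m k ℝ) {f : m' → m} {g : k' → k} (hf : f.Injective)
    (hg : g.Injective) : frobNorm (M.submatrix f g) ≤ frobNorm M := by
  refine le_of_sq_le_sq ?_ (frobNorm_nonneg _)
  rw [frobNorm_sq_eq_sum, frobNorm_sq_eq_sum]
  calc ∑ i, ∑ j, M (f i) (g j) ^ 2
      ≤ ∑ i, ∑ j, M (f i) j ^ 2 := Finset.sum_le_sum fun i _ =>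
        sum_comp_le_sum_of_injective (f := fun j => M (f i) j ^ 2) (fun _ => sq_nonneg _) hg
    _ ≤ ∑ i, ∑ j, M i j ^ 2 :=
        sum_comp_le_sum_of_injective (f := fun i => ∑ j, M i j ^ 2) (fun _ => by positivity) hf

theorem frobNorm_sq_eq_sum_col (M : Matrix m k ℝ) :
    frobNorm M ^ 2 = ∑ j, ‖toLp 2 (M.col j)‖ ^ 2 := by
  rw [frobNorm_sq_eq_sum, Finset.sum_comm]
  simp [EuclideanSpace.norm_sq_eq]

end Frobenius

section Spectral

open scoped Matrix.Norms.L2Operator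

variable {m k l : Type*} [Fintype m] [Fintype k] [Fintype l] [DecidableEq k]

theorem specNorm_nonneg (M : Matrix m k ℝ) : 0 ≤ specNorm M :=
  norm_nonneg M

theorem specNorm_zero : specNorm (0 : Matrix m k ℝ) = 0 :=
  norm_zero

theorem specNorm_diagonal (d : k → ℝ) : specNorm (diagonal d) = ‖d‖ :=
  l2_opNorm_diagonal d

theorem specNorm_transpose_mul_self (M : Matrix m k ℝ) : specNorm (Mᵀ * M) = specNorm M ^ 2 := by
  rw [← conjTranspose_eq_transpose_of_trivial, sq]
  exact l2_opNorm_conjTranspose_mul_self M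

theorem specNorm_le_one_of_transpose_mul_self {M : Matrix m k ℝ} (h : Mᵀ * M = 1) :
    specNorm M ≤ 1 := by
  have h1 : specNorm (1 : Matrix k k ℝ) ≤ 1 := by
    rw [← diagonal_one, specNorm_diagonal]
    exact (pi_norm_const_le (1 : ℝ)).trans_eq norm_one
  rwa [← h, specNorm_transpose_mul_self, sq_le_one_iff₀ (specNorm_nonneg M)] at h1

theorem norm_toEuclideanLin_le (M : Matrix m k ℝ) (x : EuclideanSpace ℝ k) :
    ‖toEuclideanLin M x‖ ≤ specNorm M * ‖x‖ :=
  l2_opNorm_mulVec M x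

theorem specNorm_le_frobNorm (M : Matrix m k ℝ) : specNorm M ≤ frobNorm M := by
  rw [specNorm, l2_opNorm_def]
  refine ContinuousLinearMap.opNorm_le_bound _ (frobNorm_nonneg _) fun x => ?_
  have h := frobNorm_mul_le M (replicateCol Unit (ofLp x))
  rw [← replicateCol_mulVec] at h
  simp only [frobNorm, frobenius_norm_replicateCol] at h
  exact h

theorem specNorm_le_frobNorm_sub_add (M N : Matrix m k ℝ) :
    specNorm M ≤ frobNorm (M - N) + specNorm N := by
  have h : specNorm (M - N + N) ≤ specNorm (M - N) + specNorm N := norm_add_le _ _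
  rw [sub_add_cancel] at h
  exact h.trans (add_le_add_left (specNorm_le_frobNorm _) _)

theorem frobNorm_mul_le_specNorm_mul (M : Matrix m k ℝ) (N : Matrix k l ℝ) :
    frobNorm (M * N) ≤ specNorm M * frobNorm N := by
  refine le_of_sq_le_sq ?_ (mul_nonneg (specNorm_nonneg _) (frobNorm_nonneg _))
  rw [mul_pow, frobNorm_sq_eq_sum_col, frobNorm_sq_eq_sum_col, Finset.mul_sum]
  refine Finset.sum_le_sum fun j _ => ?_
  rw [← mul_pow]
  exact pow_le_pow_left₀ (norm_nonneg _) (norm_toEuclideanLin_le M (toLp 2 (N.col j))) 2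

variable [DecidableEq l]

theorem specNorm_mul_le (M : Matrix m k ℝ) (N : Matrix k l ℝ) :
    specNorm (M * N) ≤ specNorm M * specNorm N :=
  l2_opNorm_mul M N

theorem specNorm_submatrix_right_le (M : Matrix m k ℝ) {g : l → k} (hg : g.Injective) :
    specNorm (M.submatrix id g) ≤ specNorm M := by
  have h : M.submatrix id g = M * (1 : Matrix k k ℝ).submatrix id g := by
    ext i j
    simp [mul_apply, one_apply]
  have h1 : ((1 : Matrix k k ℝ).submatrix id g)ᵀ * (1 : Matrix k k ℝ).submatrix id g = 1 := by
    ext i j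
    simp [mul_apply, one_apply, hg.eq_iff, eq_comm]
  rw [h]
  exact (specNorm_mul_le _ _).trans
    (mul_le_of_le_one_right (specNorm_nonneg _) (specNorm_le_one_of_transpose_mul_self h1))

theorem specNorm_transpose (M : Matrix k l ℝ) : specNorm Mᵀ = specNorm M := by
  rw [← conjTranspose_eq_transpose_of_trivial]
  exact l2_opNorm_conjTranspose M

end Spectral

theorem frobNorm_mul_le_mul_specNorm {m k l : Type*} [Fintype m] [Fintype k] [Fintype l]
    [DecidableEq l] (M : Matrix m k ℝ) (N : Matrix k l ℝ) :
    frobNorm (M * N) ≤ frobNorm M * specNorm N := by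
  classical
  rw [← frobNorm_transpose, transpose_mul, ← frobNorm_transpose M, ← specNorm_transpose N, mul_comm]
  exact frobNorm_mul_le_specNorm_mul _ _

section SingularValues

open Module

section LinearMap

variable {𝕜 E F : Type*} [RCLike 𝕜] [NormedAddCommGroup E] [InnerProductSpace 𝕜 E]
  [FiniteDimensional 𝕜 E] [NormedAddCommGroup F] [InnerProductSpace 𝕜 F] [FiniteDimensional 𝕜 F]

theorem norm_sq_eq_sum_eigenvalues_mul_norm_sq (f : E →ₗ[𝕜] F) {N : ℕ} (hN : finrank 𝕜 E = N)
    (x : E) : ‖f x‖ ^ 2 = ∑ j, f.isSymmetric_adjoint_comp_self.eigenvalues hN j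
      * ‖(f.isSymmetric_adjoint_comp_self.eigenvectorBasis hN).repr x j‖ ^ 2 := by
  set hf := f.isSymmetric_adjoint_comp_self
  calc ‖f x‖ ^ 2 = RCLike.re (inner 𝕜 x ((f.adjoint ∘ₗ f) x)) := by
        rw [LinearMap.comp_apply, LinearMap.adjoint_inner_right, inner_self_eq_norm_sq]
    _ = RCLike.re (∑ j, inner 𝕜 ((hf.eigenvectorBasis hN).repr x j)
          (hf.eigenvalues hN j * (hf.eigenvectorBasis hN).repr x j)) := by
        rw [← (hf.eigenvectorBasis hN).repr.inner_map_map, PiLp.inner_apply]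
        simp only [hf.eigenvectorBasis_apply_self_apply hN]
    _ = _ := by
        rw [map_sum]
        refine Finset.sum_congr rfl fun j _ => ?_
        rw [← smul_eq_mul, inner_smul_right, RCLike.re_ofReal_mul, inner_self_eq_norm_sq]

theorem exists_finrank_eq_forall_singularValues_mul_norm_le (f : E →ₗ[𝕜] F) {i : ℕ}
    (hi : i < finrank 𝕜 E) : ∃ S : Submodule 𝕜 E, finrank 𝕜 S = i + 1 ∧
      ∀ x ∈ S, f.singularValues i * ‖x‖ ≤ ‖f x‖ := by
  set hf := f.isSymmetric_adjoint_comp_self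
  set b := hf.eigenvectorBasis rfl with hb
  let v : Fin (i + 1) → E := fun j => b (Fin.castLE hi j)
  have hv : LinearIndependent 𝕜 v :=
    b.orthonormal.linearIndependent.comp _ (Fin.castLE_injective hi)
  refine ⟨Submodule.span 𝕜 (Set.range v), by simp [finrank_span_eq_card hv], fun x hx => ?_⟩
  have repr_eq_zero (j : Fin (finrank 𝕜 E)) (hj : i < j) : b.repr x j = 0 := by
    have span_le : Submodule.span 𝕜 (Set.range v) ≤ (b.toBasis.coord j).ker := by
      rw [Submodule.span_le]
      rintro _ ⟨a, rfl⟩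
      have ne : j ≠ Fin.castLE hi a := by
        rintro rfl
        exact absurd a.isLt (not_lt.mpr hj)
      simp [v, b.repr_self, ne]
    simpa using span_le hx
  refine le_of_sq_le_sq ?_ (norm_nonneg _)
  rw [mul_pow, ← b.repr.norm_map, EuclideanSpace.norm_sq_eq, Finset.mul_sum,
    norm_sq_eq_sum_eigenvalues_mul_norm_sq f rfl]
  refine Finset.sum_le_sum fun j _ => ?_
  rcases le_or_gt (j : ℕ) i with hj | hj
  · rw [f.sq_singularValues_of_lt rfl hi]
    gcongr
    exact hf.eigenvalues_antitone rfl hj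
  · simp [← hb, repr_eq_zero j hj]

end LinearMap

variable {m k : Type*} [Fintype m] [Fintype k] [DecidableEq k] {n : ℕ}

theorem nthSingularValue_le_specNorm (n : ℕ) (M : Matrix m k ℝ) :
    nthSingularValue n M ≤ specNorm M := by
  rcases le_or_gt (finrank ℝ (EuclideanSpace ℝ k)) (n - 1) with hle | hlt
  · rw [nthSingularValue, LinearMap.singularValues_of_finrank_le _ hle]
    exact specNorm_nonneg M
  obtain ⟨S, hS, hMS⟩ :=
    exists_finrank_eq_forall_singularValues_mul_norm_le (toEuclideanLin M) hlt
  have hS0 : S ≠ ⊥ := by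
    rintro rfl
    simp at hS
  obtain ⟨x, hxS, hx0⟩ := Submodule.exists_mem_ne_zero_of_ne_bot hS0
  exact le_of_mul_le_mul_right ((hMS x hxS).trans (norm_toEuclideanLin_le M x))
    (norm_pos_iff.mpr hx0)

namespace IsThinSVD

variable {M : Matrix m k ℝ} {U : Matrix m (Fin n) ℝ} {s : Fin n → ℝ} {V : Matrix k (Fin n) ℝ}

theorem exists_mem_norm_le (h : IsThinSVD M U s V) (i : Fin n)
    {S : Submodule ℝ (EuclideanSpace ℝ k)} (hS : n ≤ finrank ℝ S) :
    ∃ x ∈ S, x ≠ 0 ∧ ‖toEuclideanLin M x‖ ≤ s i * ‖x‖ := by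
  let g : S →ₗ[ℝ] ({j // j ≠ i} → ℝ) := LinearMap.funLeft ℝ ℝ Subtype.val ∘ₗ Vᵀ.mulVecLin ∘ₗ
    (WithLp.linearEquiv 2 ℝ (k → ℝ)).toLinearMap ∘ₗ S.subtype
  have hg : g.ker ≠ ⊥ := by
    refine LinearMap.ker_ne_bot_of_finrank_lt (lt_of_lt_of_le ?_ hS)
    simpa using i.pos
  obtain ⟨⟨x, hxS⟩, hgx, hx0⟩ := Submodule.exists_mem_ne_zero_of_ne_bot hg
  refine ⟨x, hxS, by simpa using hx0, ?_⟩
  have coord_eq_zero (j : Fin n) (hj : j ≠ i) : (Vᵀ *ᵥ ofLp x) j = 0 := congrFun hgx ⟨j, hj⟩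
  have diagonal_mulVec : diagonal s *ᵥ (Vᵀ *ᵥ ofLp x) = s i • (Vᵀ *ᵥ ofLp x) := by
    ext j
    rcases eq_or_ne j i with rfl | hj
    · simp [mulVec_diagonal]
    · simp [mulVec_diagonal, coord_eq_zero j hj]
  have hMx : toEuclideanLin M x = s i • toEuclideanLin U (toEuclideanLin Vᵀ x) := by
    rw [toLpLin_apply, toLpLin_apply, toLpLin_apply, h.eq_mul, ← mulVec_mulVec, ← mulVec_mulVec,
      diagonal_mulVec, mulVec_smul, toLp_smul]
  rw [hMx, norm_smul, Real.norm_of_nonneg (h.nonneg i)]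
  gcongr
  · exact h.nonneg i
  calc ‖toEuclideanLin U (toEuclideanLin Vᵀ x)‖
      ≤ specNorm U * (specNorm Vᵀ * ‖x‖) := (norm_toEuclideanLin_le _ _).trans
        (mul_le_mul_of_nonneg_left (norm_toEuclideanLin_le _ _) (specNorm_nonneg _))
    _ ≤ 1 * (1 * ‖x‖) := by
        rw [specNorm_transpose]
        gcongr
        · exact mul_nonneg (specNorm_nonneg V) (norm_nonneg x)
        · exact specNorm_le_one_of_transpose_mul_self h.orth_left
        · exact specNorm_le_one_of_transpose_mul_self h.orth_right
    _ = ‖x‖ := by rw [one_mul, one_mul]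

theorem nthSingularValue_sub_specNorm_le (h : IsThinSVD M U s V) (M' : Matrix m k ℝ) (i : Fin n) :
    nthSingularValue n M' - specNorm (M' - M) ≤ s i := by
  rcases le_or_gt (finrank ℝ (EuclideanSpace ℝ k)) (n - 1) with hle | hlt
  · rw [nthSingularValue, LinearMap.singularValues_of_finrank_le _ hle]
    linarith [h.nonneg i, specNorm_nonneg (M' - M)]
  obtain ⟨S, hS, hMS⟩ :=
    exists_finrank_eq_forall_singularValues_mul_norm_le (toEuclideanLin M') hlt
  obtain ⟨x, hxS, hx0, hx⟩ := h.exists_mem_norm_le i (S := S) (by omega)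
  refine le_of_mul_le_mul_right ?_ (norm_pos_iff.mpr hx0)
  have hsub := norm_toEuclideanLin_le (M' - M) x
  rw [map_sub, LinearMap.sub_apply] at hsub
  calc (nthSingularValue n M' - specNorm (M' - M)) * ‖x‖
      ≤ ‖toEuclideanLin M' x‖ - ‖toEuclideanLin M' x - toEuclideanLin M x‖ := by
        rw [sub_mul]
        exact sub_le_sub (hMS x hxS) hsub
    _ ≤ ‖toEuclideanLin M x‖ := by
        linarith [norm_sub_norm_le (toEuclideanLin M' x) (toEuclideanLin M x)]
    _ ≤ s i * ‖x‖ := hx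

theorem nthSingularValue_le (h : IsThinSVD M U s V) (i : Fin n) : nthSingularValue n M ≤ s i := by
  simpa only [sub_self, specNorm_zero, sub_zero] using h.nthSingularValue_sub_specNorm_le M i

end IsThinSVD

end SingularValues

section PolarDecomposition

theorem exists_orthonormalBasis_eq_norm_smul {𝕜 E ι : Type*} [RCLike 𝕜] [NormedAddCommGroup E]
    [InnerProductSpace 𝕜 E] [FiniteDimensional 𝕜 E] [Fintype ι]
    (hι : Module.finrank 𝕜 E = Fintype.card ι) {f : ι → E}
    (hf : Pairwise fun i j => inner 𝕜 (f i) (f j) = 0) :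
    ∃ b : OrthonormalBasis ι 𝕜 E, ∀ i, f i = (‖f i‖ : 𝕜) • b i := by
  have orthonormal : Orthonormal 𝕜 ({i | f i ≠ 0}.domRestrict fun i => (‖f i‖⁻¹ : 𝕜) • f i) := by
    refine ⟨fun i => norm_smul_inv_norm i.2, fun i j hij => ?_⟩
    simp [inner_smul_left, inner_smul_right, hf (Subtype.coe_injective.ne hij)]
  obtain ⟨b, hb⟩ := orthonormal.exists_orthonormalBasis_extension_of_card_eq hι
  refine ⟨b, fun i => ?_⟩
  rcases eq_or_ne (f i) 0 with hi | hi
  · simp [hi]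
  · rw [hb i hi, smul_inv_smul₀ (by simpa using hi)]

variable {n : Type*} [Fintype n] [DecidableEq n]

theorem exists_eq_orthogonal_mul_diagonal {N : Matrix n n ℝ} {d : n → ℝ}
    (hN : Nᵀ * N = diagonal d) :
    ∃ U ∈ orthogonalGroup n ℝ, ∃ c : n → ℝ, (∀ i, 0 ≤ c i) ∧ N = U * diagonal c := by
  have cols_orthogonal :
      Pairwise fun i j => inner ℝ (toLp 2 (N.col i)) (toLp 2 (N.col j)) = 0 := fun i j hij => by
    have h := congrFun₂ hN j i
    rw [diagonal_apply_ne _ hij.symm] at h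
    exact h
  obtain ⟨b, hb⟩ := exists_orthonormalBasis_eq_norm_smul (by simp) cols_orthogonal
  refine ⟨(EuclideanSpace.basisFun n ℝ).toBasis.toMatrix b,
    OrthonormalBasis.toMatrix_orthonormalBasis_mem_orthogonal _ _,
    fun j => ‖toLp 2 (N.col j)‖, fun _ => norm_nonneg _, ?_⟩
  ext i j
  have h := congrArg (fun x : EuclideanSpace ℝ n => x i) (hb j)
  simpa [mul_diagonal, Module.Basis.toMatrix_apply, mul_comm] using h

theorem exists_orthogonal_mul_posSemidef (M : Matrix n n ℝ) :
    ∃ T ∈ orthogonalGroup n ℝ, (M * T).PosSemidef := by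
  have hM : (Mᵀ * M).IsHermitian := isHermitian_conjTranspose_mul_self M
  set V := (hM.eigenvectorUnitary : Matrix n n ℝ)
  have hVmem : V ∈ orthogonalGroup n ℝ := hM.eigenvectorUnitary.2
  have gram_diagonal : (M * V)ᵀ * (M * V) = diagonal hM.eigenvalues := by
    have h := hM.conjStarAlgAut_star_eigenvectorUnitary
    rw [Unitary.conjStarAlgAut_star_apply] at h
    rw [transpose_mul, Matrix.mul_assoc, ← Matrix.mul_assoc Mᵀ, ← Matrix.mul_assoc]
    exact h
  obtain ⟨U, hU, c, hc, hMV⟩ := exists_eq_orthogonal_mul_diagonal gram_diagonal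
  refine ⟨V * star U, mul_mem hVmem (Unitary.star_mem hU), ?_⟩
  rw [← Matrix.mul_assoc, hMV]
  exact (PosSemidef.diagonal hc).mul_mul_conjTranspose_same U

end PolarDecomposition

section Procrustes

variable {m n k : Type*} [Fintype m] [Fintype n] [Fintype k]

-- In the application `α = OᵀO`, `β = O'ᵀO'` and `S = OᵀO' + QQ'ᵀ`, so that `Γ` is the Gram matrix
-- of the differences `O - O'` and `Q - Q'`.
theorem four_mul_frobNorm_sq_add_sub_eq {α β S Γ : Matrix m n ℝ} (hΓ : Γ = 2 • (α + β - S)) :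
    4 * frobNorm α ^ 2 + 4 * frobNorm β ^ 2 - 2 * frobNorm S ^ 2
      = 2 * frobNorm (S - 2 • α) ^ 2 + 4 * (Γᵀ * (S - 2 • α)).trace + 4 * (Γᵀ * α).trace
        + frobNorm Γ ^ 2 := by
  have hβα : (βᵀ * α).trace = (αᵀ * β).trace := by
    rw [← trace_transpose, transpose_mul, transpose_transpose]
  have hSα : (Sᵀ * α).trace = (αᵀ * S).trace := by
    rw [← trace_transpose, transpose_mul, transpose_transpose]
  have hSβ : (Sᵀ * β).trace = (βᵀ * S).trace := by
    rw [← trace_transpose, transpose_mul, transpose_transpose]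
  simp only [hΓ, frobNorm_sq_eq_trace, transpose_sub, transpose_add, transpose_smul,
    Matrix.sub_mul, Matrix.add_mul, Matrix.mul_sub, Matrix.mul_add, Matrix.smul_mul,
    Matrix.mul_smul, trace_sub, trace_add, trace_smul, nsmul_eq_mul, hβα, hSα, hSβ]
  ring

theorem four_mul_trace_le_add_frobNorm_sq {α β S Γ : Matrix m n ℝ}
    (hΓ : Γ = 2 • (α + β - S)) :
    4 * (Γᵀ * α).trace
      ≤ 4 * frobNorm α ^ 2 + 4 * frobNorm β ^ 2 - 2 * frobNorm S ^ 2 + frobNorm Γ ^ 2 := by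
  rw [four_mul_frobNorm_sq_add_sub_eq hΓ]
  linarith [frobNorm_add_sq Γ (S - 2 • α), sq_nonneg (frobNorm (Γ + (S - 2 • α)))]

theorem four_mul_trace_le_three_mul {α β S Γ : Matrix m n ℝ} (hΓ : Γ = 2 • (α + β - S))
    (hΓS : 0 ≤ (Γᵀ * S).trace) :
    4 * (Γᵀ * α).trace
      ≤ 3 * (4 * frobNorm α ^ 2 + 4 * frobNorm β ^ 2 - 2 * frobNorm S ^ 2) := by
  have hsq := frobNorm_add_sq (2 • Γ) (3 • (S - 2 • α))
  have hΓD : (Γᵀ * (S - 2 • α)).trace = (Γᵀ * S).trace - 2 * (Γᵀ * α).trace := by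
    simp [Matrix.mul_sub]
  simp only [frobNorm_sq_eq_trace (2 • Γ), frobNorm_sq_eq_trace (3 • (S - 2 • α)), transpose_smul,
    Matrix.smul_mul, Matrix.mul_smul, trace_smul, nsmul_eq_mul, ← frobNorm_sq_eq_trace] at hsq
  push_cast at hsq
  rw [four_mul_frobNorm_sq_add_sub_eq hΓ]
  nlinarith [sq_nonneg (frobNorm (2 • Γ + 3 • (S - 2 • α))), sq_nonneg (frobNorm Γ)]

open scoped MatrixOrder Matrix.Norms.L2Operator in
theorem trace_mul_nonneg {A B : Matrix n n ℝ} (hA : A.PosSemidef)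
    (hB : B.PosSemidef) : 0 ≤ (A * B).trace := by
  classical
  obtain ⟨X, rfl⟩ := CStarAlgebra.nonneg_iff_eq_star_mul_self.mp hA.nonneg
  rw [Matrix.mul_assoc, trace_mul_comm]
  exact (hB.mul_mul_conjTranspose_same X).trace_nonneg

theorem mul_trace_le_trace_mul [DecidableEq n] {W Γ : Matrix n n ℝ} {σ : ℝ}
    (hW : (W - σ • 1).PosSemidef) (hΓ : Γ.PosSemidef) : σ * Γ.trace ≤ (Γ * W).trace := by
  have h := trace_mul_nonneg hΓ hW
  rw [Matrix.mul_sub, trace_sub, Matrix.mul_smul, Matrix.mul_one, trace_smul, smul_eq_mul] at h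
  linarith

/-- `M = O Q` is a balanced factorization: the two factors have the same Gram matrix. For the
factors `O = U Σ^{1/2}` and `Q = Σ^{1/2} Vᵀ` of the Ho-Kalman algorithm this Gram matrix is `Σ`. -/
structure IsBalancedFactorization (M : Matrix m k ℝ) (O : Matrix m n ℝ) (Q : Matrix n k ℝ) :
    Prop where
  eq_mul : M = O * Q
  gram_eq : Oᵀ * O = Q * Qᵀ

namespace IsBalancedFactorization

variable {M M' : Matrix m k ℝ} {O O' : Matrix m n ℝ} {Q Q' : Matrix n k ℝ}

theorem rotate [DecidableEq n] (h : IsBalancedFactorization M O Q) {T : Matrix n n ℝ}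
    (hT : T ∈ orthogonalGroup n ℝ) : IsBalancedFactorization M (O * T) (Tᵀ * Q) := by
  have hTT : T * Tᵀ = 1 := (mem_orthogonalGroup_iff n ℝ).mp hT
  constructor
  · rw [Matrix.mul_assoc, ← Matrix.mul_assoc T, hTT, Matrix.one_mul, h.eq_mul]
  · simp only [transpose_mul, transpose_transpose, Matrix.mul_assoc]
    rw [← Matrix.mul_assoc Oᵀ, h.gram_eq, Matrix.mul_assoc]

theorem trace_transpose_mul (h : IsBalancedFactorization M O Q)
    (h' : IsBalancedFactorization M' O' Q') :
    (Mᵀ * M').trace = ((Q * Q'ᵀ)ᵀ * (Oᵀ * O')).trace := by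
  rw [h.eq_mul, h'.eq_mul, transpose_mul, transpose_mul, transpose_transpose,
    ← Matrix.mul_assoc, trace_mul_comm]
  simp only [Matrix.mul_assoc]

theorem frobNorm_sq_eq (h : IsBalancedFactorization M O Q) :
    frobNorm M ^ 2 = frobNorm (Oᵀ * O) ^ 2 := by
  rw [frobNorm_sq_eq_trace, h.trace_transpose_mul h, ← h.gram_eq, frobNorm_sq_eq_trace]

theorem four_mul_gram_sub_le (h : IsBalancedFactorization M O Q)
    (h' : IsBalancedFactorization M' O' Q') :
    4 * frobNorm (Oᵀ * O) ^ 2 + 4 * frobNorm (O'ᵀ * O') ^ 2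
        - 2 * frobNorm (Oᵀ * O' + Q * Q'ᵀ) ^ 2
      ≤ 4 * frobNorm (M - M') ^ 2 := by
  rw [frobNorm_sub_sq, h.frobNorm_sq_eq, h'.frobNorm_sq_eq, h.trace_transpose_mul h',
    add_comm (Oᵀ * O')]
  linarith [frobNorm_add_sq (Q * Q'ᵀ) (Oᵀ * O'), frobNorm_sub_sq (Q * Q'ᵀ) (Oᵀ * O'),
    sq_nonneg (frobNorm (Q * Q'ᵀ - Oᵀ * O'))]

theorem gram_sub_add_gram_sub_eq (h : IsBalancedFactorization M O Q)
    (h' : IsBalancedFactorization M' O' Q') (hS : (Oᵀ * O' + Q * Q'ᵀ).IsSymm) :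
    (O - O')ᵀ * (O - O') + (Q - Q') * (Q - Q')ᵀ
      = 2 • (Oᵀ * O + O'ᵀ * O' - (Oᵀ * O' + Q * Q'ᵀ)) := by
  have symm : O'ᵀ * O + Q' * Qᵀ = Oᵀ * O' + Q * Q'ᵀ := by
    simpa [IsSymm, transpose_mul] using hS
  calc (O - O')ᵀ * (O - O') + (Q - Q') * (Q - Q')ᵀ
      = Oᵀ * O + Q * Qᵀ + (O'ᵀ * O' + Q' * Q'ᵀ) - (Oᵀ * O' + Q * Q'ᵀ)
        - (O'ᵀ * O + Q' * Qᵀ) := by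
        simp only [transpose_sub, Matrix.sub_mul, Matrix.mul_sub]
        abel
    _ = 2 • (Oᵀ * O + O'ᵀ * O' - (Oᵀ * O' + Q * Q'ᵀ)) := by
        rw [symm, ← h.gram_eq, ← h'.gram_eq]
        abel

variable [DecidableEq n]

theorem mul_frobNorm_sub_sq_le_of_posSemidef (h : IsBalancedFactorization M O Q)
    (h' : IsBalancedFactorization M' O' Q') {σ x : ℝ} (hσ : (Oᵀ * O - σ • 1).PosSemidef)
    (hS : (Oᵀ * O' + Q * Q'ᵀ).PosSemidef)
    (hx : x = frobNorm (O - O') ^ 2 + frobNorm (Q - Q') ^ 2) :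
    σ * x ≤ 3 * frobNorm (M - M') ^ 2 ∧ 4 * (σ * x) ≤ 4 * frobNorm (M - M') ^ 2 + x ^ 2 := by
  set Γ := (O - O')ᵀ * (O - O') + (Q - Q') * (Q - Q')ᵀ with hΓ
  have Γ_eq := h.gram_sub_add_gram_sub_eq h' hS.isHermitian
  have Γ_posSemidef : Γ.PosSemidef :=
    (posSemidef_conjTranspose_mul_self (O - O')).add (posSemidef_self_mul_conjTranspose (Q - Q'))
  have Γ_symm : Γᵀ = Γ := Γ_posSemidef.isHermitian
  have Γ_trace : Γ.trace = x := by
    rw [hΓ, trace_add, trace_mul_comm (Q - Q'), ← frobNorm_sq_eq_trace, ← frobNorm_sq_eq_trace, hx]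
  have Γ_norm : frobNorm Γ ≤ x := by
    calc frobNorm Γ ≤ frobNorm (O - O')ᵀ * frobNorm (O - O')
          + frobNorm (Q - Q') * frobNorm (Q - Q')ᵀ :=
          (frobNorm_add_le _ _).trans (add_le_add (frobNorm_mul_le _ _) (frobNorm_mul_le _ _))
      _ = x := by rw [frobNorm_transpose, frobNorm_transpose, hx, sq, sq]
  have σ_mul_le : σ * x ≤ (Γᵀ * (Oᵀ * O)).trace := by
    rw [Γ_symm, ← Γ_trace]
    exact mul_trace_le_trace_mul hσ Γ_posSemidef
  have ΓS_nonneg : 0 ≤ (Γᵀ * (Oᵀ * O' + Q * Q'ᵀ)).trace :=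
    Γ_symm ▸ trace_mul_nonneg Γ_posSemidef hS
  have gram_le := h.four_mul_gram_sub_le h'
  have le_three := four_mul_trace_le_three_mul Γ_eq ΓS_nonneg
  have le_sq := four_mul_trace_le_add_frobNorm_sq Γ_eq
  have Γ_norm_sq : frobNorm Γ ^ 2 ≤ x ^ 2 := pow_le_pow_left₀ (frobNorm_nonneg Γ) Γ_norm 2
  constructor <;> linarith

theorem exists_orthogonal_mul_frobNorm_sub_sq_le (h : IsBalancedFactorization M O Q)
    (h' : IsBalancedFactorization M' O' Q') {σ : ℝ} (hσ : 0 < σ)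
    (hW : (Oᵀ * O - σ • 1).PosSemidef) (hM : frobNorm (M - M') ≤ 3 / 10 * σ) :
    ∃ T ∈ orthogonalGroup n ℝ,
      σ * (frobNorm (O - O' * T) ^ 2 + frobNorm (Q - Tᵀ * Q') ^ 2)
        ≤ 9 / 8 * frobNorm (M - M') ^ 2 := by
  obtain ⟨T, hT, hS⟩ := exists_orthogonal_mul_posSemidef (Oᵀ * O' + Q * Q'ᵀ)
  refine ⟨T, hT, ?_⟩
  have hS' : (Oᵀ * (O' * T) + Q * (Tᵀ * Q')ᵀ).PosSemidef := by
    simpa [Matrix.add_mul, Matrix.mul_assoc] using hS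
  obtain ⟨coarse, fine⟩ :=
    h.mul_frobNorm_sub_sq_le_of_posSemidef (h'.rotate hT) hW hS' rfl
  set x := frobNorm (O - O' * T) ^ 2 + frobNorm (Q - Tᵀ * Q') ^ 2
  have hx0 : 0 ≤ x := add_nonneg (sq_nonneg _) (sq_nonneg _)
  -- The coarse bound makes the quadratic term of the fine one small against `σ * x`.
  have hx : x ≤ 27 / 100 * σ := by
    refine le_of_mul_le_mul_left ?_ hσ
    nlinarith [pow_le_pow_left₀ (frobNorm_nonneg _) hM 2]
  have x_sq_le : x ^ 2 ≤ 27 / 100 * (σ * x) := by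
    linarith [mul_le_mul_of_nonneg_right hx hx0]
  linarith [mul_nonneg hσ.le hx0]

end IsBalancedFactorization

end Procrustes

section ThinSVD

theorem rank_mul_le_inner_dim {m k : Type*} [Fintype k] {n : ℕ}
    (F : Matrix m (Fin n) ℝ) (E : Matrix (Fin n) k ℝ) : (F * E).rank ≤ n :=
  (rank_mul_le_left F E).trans ((rank_le_card_width F).trans_eq (Fintype.card_fin n))

variable {m k : Type*} [Fintype m] [Fintype k] {n : ℕ}

theorem diagonal_sqrt_mul_self {s : Fin n → ℝ} (hs : ∀ i, 0 ≤ s i) :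
    diagonal (fun i => √(s i)) * diagonal (fun i => √(s i)) = diagonal s := by
  rw [diagonal_mul_diagonal]
  exact congrArg diagonal (funext fun i => Real.mul_self_sqrt (hs i))

theorem specNorm_diagonal_inv_le {s : Fin n → ℝ} {σ : ℝ} (hσ : 0 < σ) (hs : ∀ i, σ ≤ s i) :
    specNorm (diagonal fun i => (s i)⁻¹) ≤ σ⁻¹ := by
  rw [specNorm_diagonal]
  refine (pi_norm_le_iff_of_nonneg (inv_nonneg.mpr hσ.le)).mpr fun i => ?_
  rw [Real.norm_of_nonneg (inv_nonneg.mpr (hσ.le.trans (hs i)))]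
  exact inv_anti₀ hσ (hs i)

namespace IsThinSVD

variable {M : Matrix m k ℝ} {U : Matrix m (Fin n) ℝ} {s : Fin n → ℝ} {V : Matrix k (Fin n) ℝ}

protected theorem transpose (h : IsThinSVD M U s V) : IsThinSVD Mᵀ V s U where
  orth_left := h.orth_right
  orth_right := h.orth_left
  nonneg := h.nonneg
  eq_mul := by
    rw [h.eq_mul, transpose_mul, transpose_mul, diagonal_transpose, transpose_transpose,
      Matrix.mul_assoc]

protected theorem rank_le (h : IsThinSVD M U s V) : M.rank ≤ n := by
  rw [h.eq_mul, Matrix.mul_assoc]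
  exact rank_mul_le_inner_dim _ _

theorem gram_sqrt (h : IsThinSVD M U s V) :
    (U * diagonal fun i => √(s i))ᵀ * (U * diagonal fun i => √(s i)) = diagonal s := by
  rw [transpose_mul, diagonal_transpose, Matrix.mul_assoc, ← Matrix.mul_assoc Uᵀ, h.orth_left,
    Matrix.one_mul, diagonal_sqrt_mul_self h.nonneg]

theorem isBalancedFactorization (h : IsThinSVD M U s V) :
    IsBalancedFactorization M (U * diagonal fun i => √(s i)) ((diagonal fun i => √(s i)) * Vᵀ) where
  eq_mul := by
    rw [Matrix.mul_assoc, ← Matrix.mul_assoc (diagonal _), diagonal_sqrt_mul_self h.nonneg,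
      ← Matrix.mul_assoc, ← h.eq_mul]
  gram_eq := by
    rw [h.gram_sqrt, ← h.transpose.gram_sqrt, transpose_mul, transpose_mul, diagonal_transpose,
      transpose_transpose]

theorem exists_mul_mul_eq_self [DecidableEq m] (h : IsThinSVD M U s V) {σ : ℝ}
    (hσ : 0 < σ) (hs : ∀ i, σ ≤ s i) : ∃ J : Matrix k m ℝ, M * J * M = M ∧ specNorm J ≤ σ⁻¹ := by
  classical
  refine ⟨V * diagonal (fun i => (s i)⁻¹) * Uᵀ, ?_, ?_⟩
  · have inv_cancel : diagonal s * (diagonal (fun i => (s i)⁻¹) * diagonal s) = diagonal s := by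
      rw [diagonal_mul_diagonal, diagonal_mul_diagonal]
      exact congrArg diagonal (funext fun i =>
        (mul_assoc _ _ _).symm.trans (mul_inv_mul_cancel (s i)))
    calc M * (V * diagonal (fun i => (s i)⁻¹) * Uᵀ) * M
        = U * (diagonal s * ((Vᵀ * V) * (diagonal (fun i => (s i)⁻¹) *
            ((Uᵀ * U) * diagonal s)))) * Vᵀ := by
          rw [h.eq_mul]; simp only [Matrix.mul_assoc]
      _ = M := by
          rw [h.orth_left, h.orth_right, Matrix.one_mul, Matrix.one_mul, inv_cancel, ← h.eq_mul]
  · calc specNorm (V * diagonal (fun i => (s i)⁻¹) * Uᵀ)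
        ≤ specNorm V * specNorm (diagonal fun i => (s i)⁻¹) * specNorm U := by
          rw [← specNorm_transpose U]
          exact (specNorm_mul_le _ _).trans
            (mul_le_mul_of_nonneg_right (specNorm_mul_le _ _) (specNorm_nonneg _))
      _ ≤ 1 * σ⁻¹ * 1 := by
          gcongr
          exacts [specNorm_nonneg _, specNorm_nonneg _,
            specNorm_le_one_of_transpose_mul_self h.orth_right, specNorm_diagonal_inv_le hσ hs,
            specNorm_le_one_of_transpose_mul_self h.orth_left]
      _ = σ⁻¹ := by rw [one_mul, mul_one]

end IsThinSVD

end ThinSVD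

section BestRankApprox

variable {m k : Type*} [Fintype m] [Fintype k] {n : ℕ}

theorem trace_transpose_mul_eq_of_mul_eq_zero {L K R : Matrix m k ℝ} {J : Matrix k m ℝ}
    (hJ : L * J * L = L) (hKR : Kᵀ * R = 0) (hKR' : K * Rᵀ = 0) :
    (((L - K) * J * (L - K))ᵀ * R).trace = (Lᵀ * R).trace := by
  have hRK : R * Kᵀ = 0 := by
    rw [← transpose_transpose R, ← transpose_mul, hKR', transpose_zero]
  have hLR : (L - K)ᵀ * R = Lᵀ * R := by
    rw [transpose_sub, Matrix.sub_mul, hKR, sub_zero]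
  have hRL : R * (L - K)ᵀ = R * Lᵀ := by
    rw [transpose_sub, Matrix.mul_sub, hRK, sub_zero]
  calc (((L - K) * J * (L - K))ᵀ * R).trace
      = ((L - K)ᵀ * (Jᵀ * ((L - K)ᵀ * R))).trace := by
        simp only [transpose_mul, Matrix.mul_assoc]
    _ = (R * (L - K)ᵀ * (Jᵀ * Lᵀ)).trace := by
        rw [hLR, trace_mul_comm, ← Matrix.mul_assoc Jᵀ, Matrix.mul_assoc (Jᵀ * Lᵀ),
          trace_mul_comm]
    _ = (R * (L * J * L)ᵀ).trace := by
        rw [hRL]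
        simp only [transpose_mul, Matrix.mul_assoc]
    _ = (Lᵀ * R).trace := by rw [hJ, trace_mul_comm]

namespace IsBestRankApprox

variable {M K L : Matrix m k ℝ} {U U' : Matrix m (Fin n) ℝ} {s s' : Fin n → ℝ}
  {V V' : Matrix k (Fin n) ℝ}

theorem eq_of_rank_le (h : IsBestRankApprox n M K) (hM : M.rank ≤ n) : K = M := by
  have hle : frobNorm (M - K) ≤ 0 := by
    simpa only [sub_self, frobNorm_eq_zero.mpr] using h.2 M hM
  exact (sub_eq_zero.mp (frobNorm_eq_zero.mp (hle.antisymm (frobNorm_nonneg _)))).symm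

protected theorem transpose (h : IsBestRankApprox n M K) : IsBestRankApprox n Mᵀ Kᵀ := by
  refine ⟨(rank_transpose K).trans_le h.1, fun N hN => ?_⟩
  have hle := h.2 Nᵀ ((rank_transpose N).trans_le hN)
  rwa [← frobNorm_transpose, ← frobNorm_transpose (M - Nᵀ), transpose_sub, transpose_sub,
    transpose_transpose] at hle

theorem transpose_mul_sub_eq_zero (h : IsBestRankApprox n M K) (hK : IsThinSVD K U s V) :
    Kᵀ * (M - K) = 0 := by
  set P := U * (Uᵀ * M) with hP
  have hUP : Uᵀ * (M - P) = 0 := by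
    rw [Matrix.mul_sub, hP, ← Matrix.mul_assoc, hK.orth_left, Matrix.one_mul, sub_self]
  have hPK : P - K = U * (Uᵀ * M - diagonal s * Vᵀ) := by
    rw [Matrix.mul_sub, ← Matrix.mul_assoc U (diagonal s), ← hK.eq_mul]
  have hsq : frobNorm (M - K) ^ 2 = frobNorm (M - P) ^ 2 + frobNorm (P - K) ^ 2 := by
    have horth : ((M - P)ᵀ * (P - K)).trace = 0 := by
      rw [hPK, ← Matrix.mul_assoc, ← transpose_transpose U, ← transpose_mul, hUP, transpose_zero,
        Matrix.zero_mul, trace_zero]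
    rw [← sub_add_sub_cancel M P K, frobNorm_add_sq, horth, mul_zero, add_zero]
  have hle := pow_le_pow_left₀ (frobNorm_nonneg _) (h.2 P (rank_mul_le_inner_dim _ _)) 2
  have hPK_zero : P - K = 0 :=
    frobNorm_eq_zero.mp (pow_eq_zero_iff two_ne_zero |>.mp
      (le_antisymm (by linarith) (sq_nonneg _)))
  rw [← sub_add_sub_cancel M P K, hPK_zero, add_zero, hK.transpose.eq_mul, Matrix.mul_assoc, hUP,
    Matrix.mul_zero]

theorem mul_transpose_sub_eq_zero (h : IsBestRankApprox n M K) (hK : IsThinSVD K U s V) :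
    K * (M - K)ᵀ = 0 := by
  simpa using h.transpose.transpose_mul_sub_eq_zero hK.transpose

-- The residual `M - K` sees `L` only through the correction `(L - K) J (L - K)`, which is of second
-- order in `L - K`.
theorem frobNorm_sub_sq_le (h : IsBestRankApprox n M K) (hK : IsThinSVD K U' s' V')
    (hL : IsThinSVD L U s V) {σ : ℝ} (hσ : 0 < σ) (hs : ∀ i, σ ≤ s i) :
    frobNorm (L - K) ^ 2 ≤ frobNorm (L - M) ^ 2 + (frobNorm (L - K) ^ 2 / σ) ^ 2 := by
  classical
  obtain ⟨J, hJ, J_le⟩ := hL.exists_mul_mul_eq_self hσ hs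
  have hKR := h.transpose_mul_sub_eq_zero hK
  have hKR' := h.mul_transpose_sub_eq_zero hK
  set R := M - K
  set Z := (L - K) * J * (L - K)
  have Z_le : frobNorm Z ≤ frobNorm (L - K) ^ 2 / σ := by
    calc frobNorm Z ≤ frobNorm (L - K) * specNorm J * frobNorm (L - K) :=
          (frobNorm_mul_le _ _).trans (mul_le_mul_of_nonneg_right
            (frobNorm_mul_le_mul_specNorm _ _) (frobNorm_nonneg _))
      _ ≤ frobNorm (L - K) * σ⁻¹ * frobNorm (L - K) := by
          gcongr <;> exact frobNorm_nonneg _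
      _ = frobNorm (L - K) ^ 2 / σ := by ring
  have hLM : frobNorm (L - M) ^ 2
      = frobNorm (L - K) ^ 2 - 2 * (Lᵀ * R).trace + frobNorm R ^ 2 := by
    rw [← sub_sub_sub_cancel_right L M K, frobNorm_sub_sq, transpose_sub, Matrix.sub_mul, hKR,
      sub_zero]
  have hZR := frobNorm_sub_sq Z R
  rw [trace_transpose_mul_eq_of_mul_eq_zero hJ hKR hKR'] at hZR
  have Z_sq_le := pow_le_pow_left₀ (frobNorm_nonneg Z) Z_le 2
  linarith [sq_nonneg (frobNorm (Z - R))]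

theorem three_mul_frobNorm_sub_sq_le (h : IsBestRankApprox n M K) (hK : IsThinSVD K U' s' V')
    (hL : IsThinSVD L U s V) {σ : ℝ} (hσ : 0 < σ) (hs : ∀ i, σ ≤ s i)
    (hM : frobNorm (L - M) ≤ σ / 4) :
    3 * frobNorm (L - K) ^ 2 ≤ 4 * frobNorm (L - M) ^ 2 := by
  have he : frobNorm (L - K) ≤ σ / 2 := by
    have htri := frobNorm_add_le (L - M) (M - K)
    rw [sub_add_sub_cancel] at htri
    linarith [h.2 L hL.rank_le, frobNorm_sub_rev M L]
  have hdiv : frobNorm (L - K) ^ 2 / σ ≤ frobNorm (L - K) / 2 := by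
    rw [div_le_iff₀ hσ]
    nlinarith [frobNorm_nonneg (L - K)]
  have hsq := pow_le_pow_left₀ (div_nonneg (sq_nonneg _) hσ.le) hdiv 2
  linarith [h.frobNorm_sub_sq_le hK hL hσ hs, div_pow (frobNorm (L - K)) 2 2]

end IsBestRankApprox

end BestRankApprox

section Pseudoinverse

variable {m n k : Type*} [Fintype m] [Fintype n] [Fintype k]

namespace IsPseudoinverse

variable {M : Matrix m n ℝ} {X : Matrix n m ℝ}

protected theorem transpose (h : IsPseudoinverse M X) : IsPseudoinverse Mᵀ Xᵀ where
  mul_mul_self := by rw [← transpose_mul, ← transpose_mul, ← Matrix.mul_assoc, h.mul_mul_self]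
  mul_mul_inv := by rw [← transpose_mul, ← transpose_mul, ← Matrix.mul_assoc, h.mul_mul_inv]
  symm_left := by rw [← transpose_mul, transpose_transpose, h.symm_right]
  symm_right := by rw [← transpose_mul, transpose_transpose, h.symm_left]

variable [DecidableEq n]

theorem mul_eq_one (h : IsPseudoinverse M X) (hM : IsUnit (Mᵀ * M)) : X * M = 1 :=
  hM.mul_left_cancel <| by
    rw [Matrix.mul_assoc, ← Matrix.mul_assoc M, h.mul_mul_self, Matrix.mul_one]

theorem mul_transpose_mul_gram (h : IsPseudoinverse M X) (hM : IsUnit (Mᵀ * M)) :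
    X * Xᵀ * (Mᵀ * M) = 1 := by
  rw [Matrix.mul_assoc, ← Matrix.mul_assoc Xᵀ, ← transpose_mul, h.symm_left, Matrix.mul_assoc,
    h.mul_eq_one hM, Matrix.mul_one, h.mul_eq_one hM]

end IsPseudoinverse

theorem isUnit_diagonal_of_pos [DecidableEq n] {s : n → ℝ} (hs : ∀ i, 0 < s i) :
    IsUnit (diagonal s) :=
  isUnit_diagonal.mpr (Pi.isUnit_iff.mpr fun i => (hs i).ne'.isUnit)

theorem IsPseudoinverse.specNorm_le [DecidableEq m] {n : ℕ} {M : Matrix m (Fin n) ℝ}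
    {X : Matrix (Fin n) m ℝ} {s : Fin n → ℝ} {τ : ℝ} (h : IsPseudoinverse M X)
    (hM : Mᵀ * M = diagonal s) (hτ : 0 < τ) (hs : ∀ i, τ ≤ s i) : specNorm X ≤ √τ⁻¹ := by
  have hs0 : ∀ i, 0 < s i := fun i => hτ.trans_le (hs i)
  have hX : X * Xᵀ = diagonal fun i => (s i)⁻¹ := by
    refine (isUnit_diagonal_of_pos hs0).mul_right_cancel ?_
    rw [← hM, h.mul_transpose_mul_gram (hM ▸ isUnit_diagonal_of_pos hs0), hM, diagonal_mul_diagonal,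
      ← diagonal_one]
    exact congrArg diagonal (funext fun i => (inv_mul_cancel₀ (hs0 i).ne').symm)
  refine Real.le_sqrt_of_sq_le ?_
  rw [← specNorm_transpose, ← specNorm_transpose_mul_self, transpose_transpose, hX]
  exact specNorm_diagonal_inv_le hτ hs

theorem mul_mul_eq_of_mul_eq_mul [DecidableEq n] {O F : Matrix m n ℝ} {Q E : Matrix n k ℝ}
    {X : Matrix n m ℝ} {Y : Matrix k n ℝ} (h : O * Q = F * E) (hX : X * O = 1) (hY : Q * Y = 1) :
    O * X * F = F ∧ E * Y * Q = E := by
  have hinv : E * Y * (X * F) = 1 := mul_eq_one_comm.mp <| by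
    calc X * F * (E * Y) = X * (F * E) * Y := by simp only [Matrix.mul_assoc]
      _ = X * O * (Q * Y) := by rw [← h]; simp only [Matrix.mul_assoc]
      _ = 1 := by rw [hX, hY, Matrix.one_mul]
  constructor
  · calc O * X * F = O * Q * Y * X * F := by rw [Matrix.mul_assoc O Q, hY, Matrix.mul_one]
      _ = F * (E * Y * (X * F)) := by rw [h]; simp only [Matrix.mul_assoc]
      _ = F := by rw [hinv, Matrix.mul_one]
  · calc E * Y * Q = E * Y * (X * (O * Q)) := by rw [← Matrix.mul_assoc X, hX, Matrix.one_mul]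
      _ = E * Y * (X * F) * E := by rw [h]; simp only [Matrix.mul_assoc]
      _ = E := by rw [hinv, Matrix.one_mul]

theorem sub_mul_mul_eq [DecidableEq n] {O P : Matrix m n ℝ} {Q W : Matrix n k ℝ} {X : Matrix n m ℝ}
    {Y : Matrix k n ℝ} (A : Matrix n n ℝ) (H' : Matrix m k ℝ) (hX : X * P = 1) (hY : W * Y = 1) :
    A - X * H' * Y = X * (O * A * Q - H') * Y - X * (O - P) * A - A * ((Q - W) * Y)
      - X * (O - P) * A * ((Q - W) * Y) := by
  have hXO : X * O = 1 + X * (O - P) := by rw [Matrix.mul_sub, hX, add_sub_cancel]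
  have hQY : Q * Y = 1 + (Q - W) * Y := by rw [Matrix.sub_mul, hY, add_sub_cancel]
  have hexp : X * (O * A * Q - H') * Y = X * O * A * (Q * Y) - X * H' * Y := by
    simp only [Matrix.mul_sub, Matrix.sub_mul, Matrix.mul_assoc]
  rw [hexp, hXO, hQY]
  generalize X * (O - P) = α, (Q - W) * Y = β
  simp only [Matrix.add_mul, Matrix.mul_add, Matrix.one_mul, Matrix.mul_one]
  abel

theorem frobNorm_sub_mul_mul_le [DecidableEq m] [DecidableEq n] {O P : Matrix m n ℝ}
    {Q W : Matrix n k ℝ} {X : Matrix n m ℝ} {Y : Matrix k n ℝ} {A : Matrix n n ℝ}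
    {H H' : Matrix m k ℝ} {r μ : ℝ} (hH : O * A * Q = H) (hX : X * P = 1) (hY : W * Y = 1)
    (X_le : specNorm X ≤ r) (Y_le : specNorm Y ≤ r) (A_le : specNorm A ≤ μ) :
    frobNorm (A - X * H' * Y) ≤ μ * (r * frobNorm (O - P) + r * frobNorm (Q - W)
      + r ^ 2 * (frobNorm (O - P) * frobNorm (Q - W))) + r ^ 2 * frobNorm (H - H') := by
  have hr : 0 ≤ r := (specNorm_nonneg X).trans X_le
  have hμ : 0 ≤ μ := (specNorm_nonneg A).trans A_le
  have ha : frobNorm (X * (O - P)) ≤ r * frobNorm (O - P) :=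
    (frobNorm_mul_le_specNorm_mul _ _).trans (mul_le_mul_of_nonneg_right X_le (frobNorm_nonneg _))
  have hb : frobNorm ((Q - W) * Y) ≤ frobNorm (Q - W) * r :=
    (frobNorm_mul_le_mul_specNorm _ _).trans (mul_le_mul_of_nonneg_left Y_le (frobNorm_nonneg _))
  have haA : frobNorm (X * (O - P) * A) ≤ r * frobNorm (O - P) * μ :=
    (frobNorm_mul_le_mul_specNorm _ _).trans
      (mul_le_mul ha A_le (specNorm_nonneg _) (mul_nonneg hr (frobNorm_nonneg _)))
  have hAb : frobNorm (A * ((Q - W) * Y)) ≤ μ * (frobNorm (Q - W) * r) :=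
    (frobNorm_mul_le_specNorm_mul _ _).trans (mul_le_mul A_le hb (frobNorm_nonneg _) hμ)
  have haAb : frobNorm (X * (O - P) * A * ((Q - W) * Y))
      ≤ r * frobNorm (O - P) * μ * (frobNorm (Q - W) * r) :=
    (frobNorm_mul_le _ _).trans (mul_le_mul haA hb (frobNorm_nonneg _)
      (mul_nonneg (mul_nonneg hr (frobNorm_nonneg _)) hμ))
  have hD : frobNorm (X * (H - H') * Y) ≤ r * frobNorm (H - H') * r :=
    (frobNorm_mul_le_mul_specNorm _ _).trans (mul_le_mul
      ((frobNorm_mul_le_specNorm_mul _ _).trans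
        (mul_le_mul_of_nonneg_right X_le (frobNorm_nonneg _))) Y_le (specNorm_nonneg _)
      (mul_nonneg hr (frobNorm_nonneg _)))
  rw [sub_mul_mul_eq A H' hX hY, hH]
  refine (frobNorm_sub_le _ _).trans ((add_le_add ((frobNorm_sub_le _ _).trans
    (add_le_add ((frobNorm_sub_le _ _).trans (add_le_add hD haA)) hAb)) haAb).trans_eq ?_)
  ring

end Pseudoinverse

section Hankel

variable {n p : ℕ}

theorem frobNorm_hankelOf_sq_le {L : ℕ} (G : Matrix (Fin p) (Fin L × Fin p) ℝ) :
    frobNorm (hankelOf G) ^ 2 ≤ (L / 2 : ℕ) * frobNorm G ^ 2 := by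
  have blockRow_le (i : Fin (L / 2)) :
      ∑ a : Fin p, ∑ c, hankelOf G (i, a) c ^ 2 ≤ ∑ a, ∑ c, G a c ^ 2 := by
    refine Finset.sum_le_sum fun a _ => ?_
    refine sum_comp_le_sum_of_injective (f := fun c => G a c ^ 2) (fun _ => sq_nonneg _)
      (g := fun c : Fin (L / 2 + 1) × Fin p => (⟨(i : ℕ) + (c.1 : ℕ), by omega⟩, c.2)) ?_
    rintro ⟨c, b⟩ ⟨c', b'⟩ h
    simpa [Fin.ext_iff] using h
  rw [frobNorm_sq_eq_sum, frobNorm_sq_eq_sum, Fintype.sum_prod_type]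
  calc ∑ i, ∑ a, ∑ c, hankelOf G (i, a) c ^ 2
      ≤ ∑ _i : Fin (L / 2), ∑ a, ∑ c, G a c ^ 2 := Finset.sum_le_sum fun i _ => blockRow_le i
    _ = (L / 2 : ℕ) * ∑ a, ∑ c, G a c ^ 2 := by simp

theorem sqrt_two_mul_frobNorm_hankelOf_le {L : ℕ} (G : Matrix (Fin p) (Fin L × Fin p) ℝ) :
    √2 * frobNorm (hankelOf G) ≤ √L * frobNorm G := by
  refine le_of_sq_le_sq ?_ (mul_nonneg (Real.sqrt_nonneg _) (frobNorm_nonneg _))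
  rw [mul_pow, mul_pow, Real.sq_sqrt zero_le_two, Real.sq_sqrt (Nat.cast_nonneg L)]
  have hL : 2 * ((L / 2 : ℕ) : ℝ) ≤ L := by exact_mod_cast Nat.mul_div_le L 2
  nlinarith [frobNorm_hankelOf_sq_le G, mul_le_mul_of_nonneg_right hL (sq_nonneg (frobNorm G))]

theorem sqrt_two_mul_frobNorm_clippedHankel_sub_le (A : Matrix (Fin n) (Fin n) ℝ)
    (B : Matrix (Fin n) (Fin p) ℝ) (C : Matrix (Fin p) (Fin n) ℝ) {L : ℕ}
    (G : Matrix (Fin p) (Fin L × Fin p) ℝ) :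
    √2 * frobNorm (clippedHankel A B C L - hankelOf G)
      ≤ √L * frobNorm (markovMatrix A B C L - G) := by
  rw [clippedHankel_eq_hankelOf]
  exact sqrt_two_mul_frobNorm_hankelOf_le (markovMatrix A B C L - G)

theorem prodMap_id_injective {k k' : ℕ} {f : Fin k → Fin k'} (hf : f.Injective) :
    (fun c : Fin k × Fin p => (f c.1, c.2)).Injective :=
  hf.prodMap Function.injective_id

theorem frobNorm_hankelMinus_sub_le {k : ℕ}
    (H H' : Matrix (Fin k × Fin p) (Fin (k + 1) × Fin p) ℝ) :
    frobNorm (hankelMinus H - hankelMinus H') ≤ frobNorm (H - H') :=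
  frobNorm_submatrix_le (H - H') Function.injective_id
    (prodMap_id_injective (Fin.castSucc_injective k))

theorem frobNorm_hankelPlus_sub_le {k : ℕ}
    (H H' : Matrix (Fin k × Fin p) (Fin (k + 1) × Fin p) ℝ) :
    frobNorm (hankelPlus H - hankelPlus H') ≤ frobNorm (H - H') :=
  frobNorm_submatrix_le (H - H') Function.injective_id
    (prodMap_id_injective (Fin.succ_injective k))

theorem specNorm_hankelMinus_le {k : ℕ} (H : Matrix (Fin k × Fin p) (Fin (k + 1) × Fin p) ℝ) :
    specNorm (hankelMinus H) ≤ specNorm H :=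
  specNorm_submatrix_right_le H (prodMap_id_injective (Fin.castSucc_injective k))

theorem specNorm_hankelPlus_le {k : ℕ} (H : Matrix (Fin k × Fin p) (Fin (k + 1) × Fin p) ℝ) :
    specNorm (hankelPlus H) ≤ specNorm H :=
  specNorm_submatrix_right_le H (prodMap_id_injective (Fin.succ_injective k))

theorem hankelMinus_clippedHankel (A : Matrix (Fin n) (Fin n) ℝ) (B : Matrix (Fin n) (Fin p) ℝ)
    (C : Matrix (Fin p) (Fin n) ℝ) (L : ℕ) : hankelMinus (clippedHankel A B C L) =
      observabilityMatrix A C (L / 2) * controllabilityMatrix A B (L / 2) :=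
  rfl

theorem hankelPlus_clippedHankel (A : Matrix (Fin n) (Fin n) ℝ) (B : Matrix (Fin n) (Fin p) ℝ)
    (C : Matrix (Fin p) (Fin n) ℝ) (L : ℕ) : hankelPlus (clippedHankel A B C L) =
      observabilityMatrix A C (L / 2) * A * controllabilityMatrix A B (L / 2) := by
  have hshift : (controllabilityMatrix A B (L / 2 + 1)).submatrix id
      (fun c : Fin (L / 2) × Fin p => (c.1.succ, c.2)) = A * controllabilityMatrix A B (L / 2) := by
    ext i c
    have hpow : A ^ ((c.1 : ℕ) + 1) * B = A * (A ^ (c.1 : ℕ) * B) := by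
      rw [pow_succ', Matrix.mul_assoc]
    simp only [controllabilityMatrix, submatrix_apply, of_apply, Fin.val_succ, hpow]
    rfl
  rw [Matrix.mul_assoc, ← hshift]
  rfl

end Hankel

section HoKalmanFactorization

/-- The factors `O = U Σ^{1/2}` and `Q = Σ^{1/2} Vᵀ` that the Ho-Kalman algorithm extracts from a
rank-`n` approximation `K` with singular values `s`, together with their pseudoinverses `X = O†` and
`Y = Q†`. Of the singular vectors only the consequence `OᵀO = Σ = QQᵀ` is retained. -/
structure IsHoKalmanFactorization {m k : Type*} [Fintype m] [Fintype k] {n : ℕ} (K : Matrix m k ℝ)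
    (s : Fin n → ℝ) (O : Matrix m (Fin n) ℝ) (Q : Matrix (Fin n) k ℝ) (X : Matrix (Fin n) m ℝ)
    (Y : Matrix k (Fin n) ℝ) : Prop extends IsBalancedFactorization K O Q where
  gram_left : Oᵀ * O = diagonal s
  pinv_left : IsPseudoinverse O X
  pinv_right : IsPseudoinverse Q Y

namespace IsHoKalmanFactorization

variable {m k : Type*} [Fintype m] [Fintype k] {n : ℕ} {K K' : Matrix m k ℝ} {s s' : Fin n → ℝ}
  {O O' : Matrix m (Fin n) ℝ} {Q Q' : Matrix (Fin n) k ℝ} {X X' : Matrix (Fin n) m ℝ}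
  {Y Y' : Matrix k (Fin n) ℝ}

theorem gram_right (h : IsHoKalmanFactorization K s O Q X Y) : Qᵀᵀ * Qᵀ = diagonal s := by
  rw [transpose_transpose, ← h.gram_eq, h.gram_left]

theorem left_mul_eq_one (h : IsHoKalmanFactorization K s O Q X Y) (hs : ∀ i, 0 < s i) :
    X * O = 1 :=
  h.pinv_left.mul_eq_one (h.gram_left ▸ isUnit_diagonal_of_pos hs)

theorem right_mul_eq_one (h : IsHoKalmanFactorization K s O Q X Y) (hs : ∀ i, 0 < s i) :
    Q * Y = 1 := by
  rw [← transpose_inj, transpose_mul, transpose_one]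
  exact h.pinv_right.transpose.mul_eq_one (h.gram_right ▸ isUnit_diagonal_of_pos hs)

theorem gram_sub_posSemidef (h : IsHoKalmanFactorization K s O Q X Y) {σ : ℝ}
    (hs : ∀ i, σ ≤ s i) : (Oᵀ * O - σ • 1).PosSemidef := by
  rw [h.gram_left, smul_one_eq_diagonal, diagonal_sub]
  exact PosSemidef.diagonal fun i => sub_nonneg.mpr (hs i)

theorem left_mul_stateMatrix_mul_right (h : IsHoKalmanFactorization K s O Q X Y)
    (hs : ∀ i, 0 < s i) {F : Matrix m (Fin n) ℝ} {E : Matrix (Fin n) k ℝ} (hK : K = F * E)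
    (A : Matrix (Fin n) (Fin n) ℝ) : O * (X * (F * A * E) * Y) * Q = F * A * E := by
  obtain ⟨hF, hE⟩ := mul_mul_eq_of_mul_eq_mul (h.eq_mul.symm.trans hK) (h.left_mul_eq_one hs)
    (h.right_mul_eq_one hs)
  calc O * (X * (F * A * E) * Y) * Q = O * X * F * A * (E * Y * Q) := by
        simp only [Matrix.mul_assoc]
    _ = F * A * E := by rw [hF, hE]

theorem specNorm_left_le [DecidableEq m] (h : IsHoKalmanFactorization K s O Q X Y) {τ : ℝ}
    (hτ : 0 < τ) (hs : ∀ i, τ ≤ s i) : specNorm X ≤ √τ⁻¹ :=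
  h.pinv_left.specNorm_le h.gram_left hτ hs

theorem specNorm_right_le (h : IsHoKalmanFactorization K s O Q X Y) {τ : ℝ} (hτ : 0 < τ)
    (hs : ∀ i, τ ≤ s i) : specNorm Y ≤ √τ⁻¹ := by
  classical
  rw [← specNorm_transpose]
  exact h.pinv_right.transpose.specNorm_le h.gram_right hτ hs

variable [DecidableEq k]

theorem specNorm_stateMatrix_le (h : IsHoKalmanFactorization K s O Q X Y) {τ : ℝ} (hτ : 0 < τ)
    (hs : ∀ i, τ ≤ s i) (H : Matrix m k ℝ) : specNorm (X * H * Y) ≤ specNorm H / τ := by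
  classical
  calc specNorm (X * H * Y) ≤ specNorm X * specNorm H * specNorm Y :=
        (specNorm_mul_le _ _).trans
          (mul_le_mul_of_nonneg_right (specNorm_mul_le _ _) (specNorm_nonneg _))
    _ ≤ √τ⁻¹ * specNorm H * √τ⁻¹ := by
        gcongr
        exacts [specNorm_nonneg Y, mul_nonneg (Real.sqrt_nonneg _) (specNorm_nonneg H),
          specNorm_nonneg H, h.specNorm_left_le hτ hs, h.specNorm_right_le hτ hs]
    _ = specNorm H / τ := by
        rw [mul_right_comm, Real.mul_self_sqrt (inv_nonneg.mpr hτ.le), inv_mul_eq_div]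

theorem frobNorm_stateMatrix_sub_le (h : IsHoKalmanFactorization K s O Q X Y)
    (h' : IsHoKalmanFactorization K' s' O' Q' X' Y') {T : Matrix (Fin n) (Fin n) ℝ}
    (hT : T ∈ orthogonalGroup (Fin n) ℝ) {σ τ : ℝ} (hσ : 0 < σ) (hτ : 0 < τ) (hs : ∀ i, σ ≤ s i)
    (hs' : ∀ i, τ ≤ s' i) {H H' : Matrix m k ℝ} (hH : O * (X * H * Y) * Q = H) :
    frobNorm (X * H * Y - Tᵀ * (X' * H' * Y') * T)
      ≤ specNorm H / σ * (√τ⁻¹ * frobNorm (O - O' * T) + √τ⁻¹ * frobNorm (Q - Tᵀ * Q')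
          + √τ⁻¹ ^ 2 * (frobNorm (O - O' * T) * frobNorm (Q - Tᵀ * Q')))
        + √τ⁻¹ ^ 2 * frobNorm (H - H') := by
  classical
  have hTT : Tᵀ * T = 1 := (mem_orthogonalGroup_iff' (Fin n) ℝ).mp hT
  have T_le : specNorm T ≤ 1 := specNorm_le_one_of_transpose_mul_self hTT
  have hs'_pos : ∀ i, 0 < s' i := fun i => hτ.trans_le (hs' i)
  have hXP : Tᵀ * X' * (O' * T) = 1 := by
    rw [Matrix.mul_assoc, ← Matrix.mul_assoc X', h'.left_mul_eq_one hs'_pos, Matrix.one_mul, hTT]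
  have hWY : Tᵀ * Q' * (Y' * T) = 1 := by
    rw [Matrix.mul_assoc, ← Matrix.mul_assoc Q', h'.right_mul_eq_one hs'_pos, Matrix.one_mul, hTT]
  have X_le : specNorm (Tᵀ * X') ≤ √τ⁻¹ :=
    (specNorm_mul_le _ _).trans ((mul_le_of_le_one_left (specNorm_nonneg _)
      ((specNorm_transpose T).trans_le T_le)).trans (h'.specNorm_left_le hτ hs'))
  have Y_le : specNorm (Y' * T) ≤ √τ⁻¹ :=
    (specNorm_mul_le _ _).trans ((mul_le_of_le_one_right (specNorm_nonneg _) T_le).trans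
      (h'.specNorm_right_le hτ hs'))
  have hrotate : Tᵀ * (X' * H' * Y') * T = Tᵀ * X' * H' * (Y' * T) := by
    simp only [Matrix.mul_assoc]
  rw [hrotate]
  exact frobNorm_sub_mul_mul_le hH hXP hWY X_le Y_le (h.specNorm_stateMatrix_le hσ hs H)

end IsHoKalmanFactorization

theorem IsThinSVD.isHoKalmanFactorization {m k : Type*} [Fintype m] [Fintype k] {n : ℕ}
    {K : Matrix m k ℝ} {U : Matrix m (Fin n) ℝ} {s : Fin n → ℝ} {V : Matrix k (Fin n) ℝ}
    {X : Matrix (Fin n) m ℝ} {Y : Matrix k (Fin n) ℝ} (h : IsThinSVD K U s V)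
    (hX : IsPseudoinverse (U * diagonal fun i => √(s i)) X)
    (hY : IsPseudoinverse ((diagonal fun i => √(s i)) * Vᵀ) Y) :
    IsHoKalmanFactorization K s (U * diagonal fun i => √(s i)) ((diagonal fun i => √(s i)) * Vᵀ)
      X Y where
  toIsBalancedFactorization := h.isBalancedFactorization
  gram_left := h.gram_sqrt
  pinv_left := hX
  pinv_right := hY

end HoKalmanFactorization

section Robustness

theorem IsBestRankApprox.frobNorm_sub_le_of_frobNorm_sub_le {m k : Type*} [Fintype m] [Fintype k]
    {n : ℕ} {M K L : Matrix m k ℝ} {U U' : Matrix m (Fin n) ℝ}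
    {s s' : Fin n → ℝ} {V V' : Matrix k (Fin n) ℝ} (h : IsBestRankApprox n M K)
    (hK : IsThinSVD K U' s' V') (hL : IsThinSVD L U s V) {σ : ℝ} (hσ : 0 < σ) (hs : ∀ i, σ ≤ s i)
    (hM : frobNorm (L - M) ≤ σ / 4) : frobNorm (L - K) ≤ 3 / 10 * σ := by
  refine le_of_sq_le_sq ?_ (by positivity)
  nlinarith [h.three_mul_frobNorm_sub_sq_le hK hL hσ hs hM,
    pow_le_pow_left₀ (frobNorm_nonneg _) hM 2]

theorem add_add_mul_le_of_sq_add_sq_le {σ a b d r : ℝ} (hσ : 0 < σ) (hd0 : 0 ≤ d) (hd : d ≤ σ / 4)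
    (hr : r ^ 2 = 10 / 7 / σ) (hab : σ * (a ^ 2 + b ^ 2) ≤ 3 / 2 * d ^ 2) :
    r * a + r * b + r ^ 2 * (a * b) ≤ 12 / 5 * (d / σ) := by
  have hδ : d / σ ≤ 1 / 4 := (div_le_iff₀ hσ).mpr (by linarith)
  have hsq : (r * a) ^ 2 + (r * b) ^ 2 ≤ 15 / 7 * (d / σ) ^ 2 :=
    calc (r * a) ^ 2 + (r * b) ^ 2 = 10 / 7 / σ ^ 2 * (σ * (a ^ 2 + b ^ 2)) := by
          rw [mul_pow, mul_pow, hr]; field_simp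
      _ ≤ 10 / 7 / σ ^ 2 * (3 / 2 * d ^ 2) := by gcongr
      _ = 15 / 7 * (d / σ) ^ 2 := by ring
  have hsum : r * a + r * b ≤ 21 / 10 * (d / σ) := by
    refine le_of_sq_le_sq ?_ (by positivity)
    nlinarith [sq_nonneg (r * a - r * b)]
  have hprod : r ^ 2 * (a * b) ≤ 15 / 14 * (d / σ) ^ 2 := by
    nlinarith [sq_nonneg (r * a - r * b)]
  nlinarith [div_nonneg hd0 hσ.le]

theorem div_mul_add_le_sqrt_two_mul {σ e d h h' : ℝ} (hσ : 0 < σ) (he : e ≤ 12 / 5 * (d / σ))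
    (hd0 : 0 ≤ d) (hd : d ≤ σ / 4) (hh : σ ≤ h) (hh' : h ≤ d + h') :
    h / σ * e + 10 / 7 / σ * d ≤ √2 * ((h + h') / σ ^ 2 + 1 / σ) * d := by
  have hη : 1 ≤ h / σ := (one_le_div hσ).mpr hh
  have hsqrt : 7 / 5 ≤ √2 := Real.le_sqrt_of_sq_le (by norm_num)
  have hsum : (2 * (h / σ) + 3 / 4) / σ ≤ (h + h') / σ ^ 2 + 1 / σ :=
    calc (2 * (h / σ) + 3 / 4) / σ = (2 * h - σ / 4) / σ ^ 2 + 1 / σ := by field_simp; ring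
      _ ≤ (h + h') / σ ^ 2 + 1 / σ := by gcongr; linarith
  calc h / σ * e + 10 / 7 / σ * d ≤ h / σ * (12 / 5 * (d / σ)) + 10 / 7 / σ * d := by gcongr
    _ = (12 / 5 * (h / σ) + 10 / 7) * (d / σ) := by ring
    _ ≤ 7 / 5 * (2 * (h / σ) + 3 / 4) * (d / σ) :=
        mul_le_mul_of_nonneg_right (by linarith) (div_nonneg hd0 hσ.le)
    _ = 7 / 5 * ((2 * (h / σ) + 3 / 4) / σ) * d := by ring
    _ ≤ √2 * ((h + h') / σ ^ 2 + 1 / σ) * d := by gcongr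

theorem IsThinSVD.seven_tenths_mul_nthSingularValue_le {m k : Type*} [Fintype m] [Fintype k]
    [DecidableEq k] {n : ℕ} {L K : Matrix m k ℝ} {U : Matrix m (Fin n) ℝ} {s : Fin n → ℝ}
    {V : Matrix k (Fin n) ℝ} (hK : IsThinSVD K U s V)
    (hLK : frobNorm (L - K) ≤ 3 / 10 * nthSingularValue n L) (i : Fin n) :
    7 / 10 * nthSingularValue n L ≤ s i := by
  linarith [hK.nthSingularValue_sub_specNorm_le L i, specNorm_le_frobNorm (L - K)]

theorem IsHoKalmanFactorization.exists_orthogonal_mul_frobNorm_sub_sq_le {m k : Type*} [Fintype m]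
    [Fintype k] {n : ℕ} {L K : Matrix m k ℝ} {s s' : Fin n → ℝ}
    {O O' : Matrix m (Fin n) ℝ} {Q Q' : Matrix (Fin n) k ℝ} {X X' : Matrix (Fin n) m ℝ}
    {Y Y' : Matrix k (Fin n) ℝ} (h : IsHoKalmanFactorization L s O Q X Y)
    (h' : IsHoKalmanFactorization K s' O' Q' X' Y') {σ d : ℝ} (hσ : 0 < σ) (hs : ∀ i, σ ≤ s i)
    (hLK : frobNorm (L - K) ≤ 3 / 10 * σ) (hd : 3 * frobNorm (L - K) ^ 2 ≤ 4 * d ^ 2) :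
    ∃ T ∈ orthogonalGroup (Fin n) ℝ,
      σ * (frobNorm (O - O' * T) ^ 2 + frobNorm (Q - Tᵀ * Q') ^ 2) ≤ 3 / 2 * d ^ 2 := by
  obtain ⟨T, hT, hle⟩ := h.toIsBalancedFactorization.exists_orthogonal_mul_frobNorm_sub_sq_le
    h'.toIsBalancedFactorization hσ (h.gram_sub_posSemidef hs) hLK
  exact ⟨T, hT, by linarith⟩

theorem IsHoKalmanFactorization.frobNorm_stateMatrix_sub_le_sqrt_two_mul {m k : Type*} [Fintype m]
    [Fintype k] [DecidableEq k] {n : ℕ} {L K : Matrix m k ℝ} {s s' : Fin n → ℝ}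
    {O O' : Matrix m (Fin n) ℝ} {Q Q' : Matrix (Fin n) k ℝ} {X X' : Matrix (Fin n) m ℝ}
    {Y Y' : Matrix k (Fin n) ℝ} (h : IsHoKalmanFactorization L s O Q X Y)
    (h' : IsHoKalmanFactorization K s' O' Q' X' Y') {σ d η η' : ℝ} (hσ : 0 < σ)
    (hs : ∀ i, σ ≤ s i) (hs' : ∀ i, 7 / 10 * σ ≤ s' i) {T : Matrix (Fin n) (Fin n) ℝ}
    (hT : T ∈ orthogonalGroup (Fin n) ℝ)
    (hOQ : σ * (frobNorm (O - O' * T) ^ 2 + frobNorm (Q - Tᵀ * Q') ^ 2) ≤ 3 / 2 * d ^ 2)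
    {H H' : Matrix m k ℝ} (hH : O * (X * H * Y) * Q = H) (hd : frobNorm (H - H') ≤ d)
    (hdσ : d ≤ σ / 4) (hHη : specNorm H ≤ η) (hση : σ ≤ η) (hη : η ≤ d + η') :
    frobNorm (X * H * Y - Tᵀ * (X' * H' * Y') * T)
      ≤ √2 * ((η + η') / σ ^ 2 + 1 / σ) * d := by
  have hr : √(7 / 10 * σ)⁻¹ ^ 2 = 10 / 7 / σ := by
    rw [Real.sq_sqrt (by positivity), mul_inv, div_eq_mul_inv _ σ]
    norm_num
  have hd0 : 0 ≤ d := (frobNorm_nonneg _).trans hd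
  have herr := add_add_mul_le_of_sq_add_sq_le hσ hd0 hdσ hr hOQ
  have hstate := h.frobNorm_stateMatrix_sub_le h' hT hσ (by positivity) hs hs' (H' := H') hH
  have ha := frobNorm_nonneg (O - O' * T)
  have hb := frobNorm_nonneg (Q - Tᵀ * Q')
  refine hstate.trans (le_trans ?_ (div_mul_add_le_sqrt_two_mul hσ herr hd0 hdσ hση hη))
  rw [hr]
  gcongr

theorem IsHoKalmanOutput.exists_factorization {n p k : ℕ} {hk : 0 < k}
    {H : Matrix (Fin k × Fin p) (Fin (k + 1) × Fin p) ℝ} {A : Matrix (Fin n) (Fin n) ℝ}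
    {B : Matrix (Fin n) (Fin p) ℝ} {C : Matrix (Fin p) (Fin n) ℝ}
    (h : IsHoKalmanOutput n hk H A B C) :
    ∃ K U s V O Q X Y, IsBestRankApprox n (hankelMinus H) K ∧ IsThinSVD K U s V ∧
      IsHoKalmanFactorization K s O Q X Y ∧ A = X * hankelPlus H * Y ∧
      B = Q.submatrix id (fun b => (⟨0, hk⟩, b)) ∧ C = O.submatrix (fun a => (⟨0, hk⟩, a)) id := by
  obtain ⟨K, U, s, V, _, _, X, Y, hK, hSVD, rfl, rfl, hX, hY, hC, hB, hA⟩ := h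
  exact ⟨K, U, s, V, _, _, X, Y, hK, hSVD, hSVD.isHoKalmanFactorization hX hY, hA, hB, hC⟩

theorem max_le_sqrt_div_mul {σ a b d : ℝ} (hσ : 0 < σ) (hd : 0 ≤ d)
    (hab : σ * (a ^ 2 + b ^ 2) ≤ 3 / 2 * d ^ 2) : max a b ≤ √(2 / σ) * d := by
  have hsq : a ^ 2 + b ^ 2 ≤ (√(2 / σ) * d) ^ 2 := by
    rw [mul_pow, Real.sq_sqrt (by positivity), div_mul_eq_mul_div, le_div_iff₀' hσ]
    nlinarith [sq_nonneg d]
  exact max_le (le_of_sq_le_sq (by linarith [sq_nonneg b]) (by positivity))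
    (le_of_sq_le_sq (by linarith [sq_nonneg a]) (by positivity))

theorem le_div_four_of_sqrt_two_mul_le {σ d g ℓ : ℝ} (hℓ : 0 < ℓ) (hdg : √2 * d ≤ √ℓ * g)
    (hg : g ≤ σ / (2 * √(2 * ℓ))) : d ≤ σ / 4 := by
  have hsqrt : √(2 * ℓ) = √2 * √ℓ := Real.sqrt_mul zero_le_two ℓ
  have hscaled : √2 * d ≤ √2 * (σ / 4) :=
    calc √2 * d ≤ √ℓ * (σ / (2 * √(2 * ℓ))) := hdg.trans (by gcongr)
      _ = √2 * (σ / 4) := by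
        rw [hsqrt]
        field_simp
        rw [Real.sq_sqrt zero_le_two]
        ring
  exact le_of_mul_le_mul_left hscaled (by positivity)

theorem IsHoKalmanOutput.exists_orthogonal_frobNorm_sub_le {n p k : ℕ} {hk : 0 < k}
    {H H' : Matrix (Fin k × Fin p) (Fin (k + 1) × Fin p) ℝ} {A A' : Matrix (Fin n) (Fin n) ℝ}
    {B B' : Matrix (Fin n) (Fin p) ℝ} {C C' : Matrix (Fin p) (Fin n) ℝ}
    (h : IsHoKalmanOutput n hk H A B C) (h' : IsHoKalmanOutput n hk H' A' B' C')
    {F : Matrix (Fin k × Fin p) (Fin n) ℝ} {E : Matrix (Fin n) (Fin k × Fin p) ℝ}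
    {A₀ : Matrix (Fin n) (Fin n) ℝ} (hminus : hankelMinus H = F * E)
    (hplus : hankelPlus H = F * A₀ * E) {σ : ℝ} (hσ : nthSingularValue n (hankelMinus H) = σ)
    (hσ_pos : 0 < σ) (hd : frobNorm (H - H') ≤ σ / 4) :
    ∃ T ∈ orthogonalGroup (Fin n) ℝ,
      max (frobNorm (B - Tᵀ * B')) (frobNorm (C - C' * T)) ≤ √(2 / σ) * frobNorm (H - H') ∧
      frobNorm (A - Tᵀ * A' * T)
        ≤ √2 * ((specNorm H + specNorm H') / σ ^ 2 + 1 / σ) * frobNorm (H - H') := by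
  obtain ⟨K, U, s, V, O, Q, X, Y, hK, hSVD, hfac, rfl, rfl, rfl⟩ := h.exists_factorization
  obtain ⟨K', U', s', V', O', Q', X', Y', hK', hSVD', hfac', rfl, rfl, rfl⟩ :=
    h'.exists_factorization
  obtain rfl : K = hankelMinus H := hK.eq_of_rank_le (hminus ▸ rank_mul_le_inner_dim F E)
  subst hσ
  have hs := hSVD.nthSingularValue_le
  have hdminus := frobNorm_hankelMinus_sub_le H H'
  have hKK' := hK'.frobNorm_sub_le_of_frobNorm_sub_le hSVD' hSVD hσ_pos hs (hdminus.trans hd)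
  have hsq : 3 * frobNorm (hankelMinus H - K') ^ 2 ≤ 4 * frobNorm (H - H') ^ 2 :=
    (hK'.three_mul_frobNorm_sub_sq_le hSVD' hSVD hσ_pos hs (hdminus.trans hd)).trans <|
      mul_le_mul_of_nonneg_left (pow_le_pow_left₀ (frobNorm_nonneg _) hdminus 2) (by norm_num)
  obtain ⟨T, hT, hOQ⟩ := hfac.exists_orthogonal_mul_frobNorm_sub_sq_le hfac' hσ_pos hs hKK' hsq
  have B_le : frobNorm (Q.submatrix id (fun b => (⟨0, hk⟩, b))
      - Tᵀ * Q'.submatrix id (fun b => (⟨0, hk⟩, b))) ≤ frobNorm (Q - Tᵀ * Q') :=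
    frobNorm_submatrix_le (Q - Tᵀ * Q') Function.injective_id (Prod.mk_right_injective _)
  have C_le : frobNorm (O.submatrix (fun a => (⟨0, hk⟩, a)) id
      - O'.submatrix (fun a => (⟨0, hk⟩, a)) id * T) ≤ frobNorm (O - O' * T) :=
    frobNorm_submatrix_le (O - O' * T) (Prod.mk_right_injective _) Function.injective_id
  refine ⟨T, hT, ?_, ?_⟩
  · exact (max_comm _ _).trans_le ((max_le_max C_le B_le).trans
      (max_le_sqrt_div_mul hσ_pos (frobNorm_nonneg _) hOQ))
  · exact hfac.frobNorm_stateMatrix_sub_le_sqrt_two_mul hfac' hσ_pos hs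
      (hSVD'.seven_tenths_mul_nthSingularValue_le hKK') hT hOQ
      (hplus ▸ hfac.left_mul_stateMatrix_mul_right
        (fun i => hσ_pos.trans_le (hs i)) hminus A₀)
      (frobNorm_hankelPlus_sub_le H H') hd (specNorm_hankelPlus_le H)
      ((nthSingularValue_le_specNorm n _).trans (specNorm_hankelMinus_le H))
      (specNorm_le_frobNorm_sub_add H H')

end Robustness

end HoKalman

theorem mainTheorem4 (n p L : ℕ) (hn : 1 ≤ n) (hL : 2 ≤ L)
    (A : Matrix (Fin n) (Fin n) ℝ) (B : Matrix (Fin n) (Fin p) ℝ) (C : Matrix (Fin p) (Fin n) ℝ)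
    (hctrl : HoKalman.IsControllable A B) (hobs : HoKalman.IsObservable A C)
    (Ghat : Matrix (Fin p) (Fin L × Fin p) ℝ)
    (Lmat : Matrix (Fin (L / 2) × Fin p) (Fin (L / 2) × Fin p) ℝ)
    (hLmat : HoKalman.IsBestRankApprox n
      (HoKalman.hankelMinus (HoKalman.clippedHankel A B C L)) Lmat)
    (hσ : 0 < HoKalman.nthSingularValue n Lmat)
    (hG : HoKalman.frobNorm (HoKalman.markovMatrix A B C L - Ghat)
      ≤ HoKalman.nthSingularValue n Lmat / (2 * Real.sqrt (2 * (L : ℝ))))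
    (Abar Ahat : Matrix (Fin n) (Fin n) ℝ) (Bbar Bhat : Matrix (Fin n) (Fin p) ℝ)
    (Cbar Chat : Matrix (Fin p) (Fin n) ℝ)
    (hbar : HoKalman.IsHoKalmanOutput n (Nat.div_pos hL two_pos)
      (HoKalman.clippedHankel A B C L) Abar Bbar Cbar)
    (hhat : HoKalman.IsHoKalmanOutput n (Nat.div_pos hL two_pos)
      (HoKalman.hankelOf Ghat) Ahat Bhat Chat) :
    ∃ T ∈ Matrix.orthogonalGroup (Fin n) ℝ,
      max (HoKalman.frobNorm (Bbar - T.transpose * Bhat))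
          (HoKalman.frobNorm (Cbar - Chat * T))
        ≤ Real.sqrt ((L : ℝ) / HoKalman.nthSingularValue n Lmat)
          * HoKalman.frobNorm (HoKalman.markovMatrix A B C L - Ghat) ∧
      HoKalman.frobNorm (Abar - T.transpose * Ahat * T)
        ≤ Real.sqrt (L : ℝ)
          * ((HoKalman.specNorm (HoKalman.clippedHankel A B C L)
                + HoKalman.specNorm (HoKalman.hankelOf Ghat))
              / HoKalman.nthSingularValue n Lmat ^ 2
            + 1 / HoKalman.nthSingularValue n Lmat)
          * HoKalman.frobNorm (HoKalman.markovMatrix A B C L - Ghat) := by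
  obtain rfl : Lmat = HoKalman.hankelMinus (HoKalman.clippedHankel A B C L) :=
    hLmat.eq_of_rank_le (HoKalman.rank_mul_le_inner_dim _ _)
  set σ := HoKalman.nthSingularValue n (HoKalman.hankelMinus (HoKalman.clippedHankel A B C L))
  set d := HoKalman.frobNorm (HoKalman.clippedHankel A B C L - HoKalman.hankelOf Ghat)
  set g := HoKalman.frobNorm (HoKalman.markovMatrix A B C L - Ghat)
  have hdg : √2 * d ≤ √L * g :=
    HoKalman.sqrt_two_mul_frobNorm_clippedHankel_sub_le A B C Ghat
  have hdσ : d ≤ σ / 4 := HoKalman.le_div_four_of_sqrt_two_mul_le (by positivity) hdg hG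
  obtain ⟨T, hT, hBC, hA⟩ := hbar.exists_orthogonal_frobNorm_sub_le hhat
    (HoKalman.hankelMinus_clippedHankel A B C L) (HoKalman.hankelPlus_clippedHankel A B C L)
    rfl hσ hdσ
  refine ⟨T, hT, hBC.trans ?_, hA.trans ?_⟩
  · rw [Real.sqrt_div zero_le_two, Real.sqrt_div L.cast_nonneg, div_mul_eq_mul_div,
      div_mul_eq_mul_div]
    gcongr
  · rw [mul_right_comm, mul_right_comm √L]
    have hH := HoKalman.specNorm_nonneg (HoKalman.clippedHankel A B C L)
    have hHhat := HoKalman.specNorm_nonneg (HoKalman.hankelOf Ghat)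
    gcongr
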